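/- **Conventions.** Bernoulli numbers: $\frac{t}{e^t-1}=\sum_i \frac{B_i}{i!}t^i$ (so $B_1=-\tfrac12$), and $B_n^+:=(-1)^nB_n$ (so $B_1^+=\tfrac12$ and $B_n^+=B_n$ for $n\neq 1$). For $s\in\mathbb C$ let $\sigma_s(\xi)=\xi^{-s}$ for $\xi\ge 1$ and $\sigma_s(\xi)=0$ for $\xi<1$; thus $\sigma_s\sigma_t=\sigma_{s+t}$. Let $\mathcal A=\bigoplus_{s\in\mathbb C}\mathbb C\,\sigma_s$ and let $T(\mathcal A)$ be its tensor algebra. The cut-off nested sum is the linear form on $T(\mathcal A)$ given by $$\sigma_{s_1}\otimes\cdots\otimes\sigma_{s_k}\longmapsto \operatorname{fp}_{N\to\infty}\sum_{0\le n_k<\cdots<n_1\le N}\sigma_{s_1}(n_1)\cdots\sigma_{s_k}(n_k),$$ where $\operatorname{fp}_{N\to\infty}$ is the constant term of the asymptotic expansion in the functions $N^{\alpha}\log^l N$ ($\alpha\in\mathbb C$, $l\in\mathbb N$). Let $\exp$, $\log$ be Hoffman's mutually inverse maps on $T(\mathcal A)$, $$\exp u=\sum_{I=(i_1,\dots,i_k)}\frac{I[u]}{i_1!\cdots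 i_k!},\qquad \log u=\sum_{I=(i_1,\dots,i_k)}\frac{(-1)^{n-k}}{i_1\cdots i_k}I[u]$$ ($u$ of degree $n$, $I$ over the compositions of $n$, $I[u]$ obtained by multiplying together the factors in each block of $I$), let $\widetilde{\mathcal R}(\sigma_{s_1}\otimes\cdots\otimes\sigma_{s_m})(z_1,z_2,\dots)=\sigma_{s_1+z_1}\otimes\cdots\otimes\sigma_{s_m+z_m}$ and $\widetilde{\mathcal R}^*=\exp\circ\widetilde{\mathcal R}\circ\log$. Write $\Psi(\sigma_{s_1}\otimes\cdots\otimes\sigma_{s_k})(z_1,\dots,z_k)$ for the cut-off nested sum of $\widetilde{\mathcal R}^*(\sigma_{s_1}\otimes\cdots\otimes\sigma_{s_k})(z_1,\dots,z_k)$, and $\psi(\cdot)(z)$ for its restriction to $z_1=\cdots=z_k=z$. For a function $f$ meromorphic at $0$ let $\Pi f$ be the pole part of its Laurent series at $0$ and $\mathrm{ev}^{\rm reg}_{0}(f)=(f-\Pi f)(0)$. Put $\mathrm{ev}_0^{\rm ren,sym}=\frac12\left(\mathrm{ev}^{\rm reg}_{z_2=0}\circ\mathrm{ev}^{\rm reg}_{z_1=0}+\mathrm{ev}^{\rm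 reg}_{z_1=0}\circ\mathrm{ev}^{\rm reg}_{z_2=0}\right)$. **Statement.** Let $a_1,a_2\ge 0$ be integers. 1. For $(z_1,z_2)$ near $(0,0)$ with $z_1\ne0$ and $z_1+z_2\neq 0$ the finite parts defining $\Psi(\sigma_{-a_1}\otimes\sigma_{-a_2})(z_1,z_2)$ exist, every evaluation $\mathrm{ev}^{\rm reg}$ in $\mathrm{ev}_0^{\rm ren,sym}$ is applied to a germ that is meromorphic at $0$, and $\zeta^{\rm ev}(-a_1,-a_2):=\mathrm{ev}_0^{\rm ren,sym}\big(\Psi(\sigma_{-a_1}\otimes\sigma_{-a_2})(z_1,z_2)\big)$ equals $$-\frac1{a_2+1}\sum_{j=0}^{a_2+1}B_j\binom{a_2+1}{j}\frac{B^+_{a_1+a_2-j+2}}{a_1+a_2-j+2}+\frac{B^+_{a_1+1}}{a_1+1}\,\frac{B^+_{a_2+1}}{a_2+1}+(-1)^{a_1+1}a_1!\,a_2!\,\frac{B_{a_1+a_2+2}}{2\,(a_1+a_2+2)!}.$$ If $a_2\ge1$, the same formula holds with $B$ in place of $B^+$ throughout. In particular $\zeta^{\rm ev}(-a_1,-a_2)$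 is rational. 2. The finite parts defining $\psi(w)(z)$ exist for small $z\neq0$, and $\psi(w)$ is meromorphic at $0$, for $w=\sigma_{-a_1},\ \sigma_{-a_2},\ \sigma_{-a_1}\otimes\sigma_{-a_2}$. Regard $\psi$ as a linear map $T(\mathcal A)\to\mathbb C[\varepsilon^{-1},\varepsilon]]$ by taking Laurent series at $z=0$, where by convention a basis tensor $w$ is sent to $0$ if $\psi(w)$ is not meromorphic at $0$. With the convolution $\star$ for the deconcatenation coproduct, $\psi$ has exactly one algebraic Birkhoff decomposition $\psi=\psi_-^{\star(-1)}\star\psi_+$, that is, one with $\psi_\pm$ linear, $\psi_\pm(1)=1$, and $\psi_-$ (resp. $\psi_+$) mapping the kernel of the counit into the range of $\Pi$ (resp. of $\mathrm{id}-\Pi$). Its value $\zeta^{\rm Birk}(-a_1,-a_2):=\psi_+(\sigma_{-a_1}\otimes\sigma_{-a_2})\big|_{\varepsilon=0}$ satisfies $$\zeta^{\rm Birk}(-a_1,-a_2)=\zeta^{\rm ev}(-a_1,-a_2).$$ -/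

import Mathlib

open Filter Topology

/-! ### Symbols and their tensor algebra -/

/-- The symbol `σ_s`, modulo functions supported in `(0,1)`: it is `ξ ^ (-s)` for `ξ ≥ 1`, and
we take the representative that vanishes for `ξ < 1`. -/
noncomputable def zetaSymbol (s : ℂ) (ξ : ℝ) : ℂ :=
  if 1 ≤ ξ then (ξ : ℂ) ^ (-s) else 0

/-- The symbols `σ_s` are multiplied by adding the exponents. -/
theorem zetaSymbol_mul (s t : ℂ) (ξ : ℝ) :
    zetaSymbol s ξ * zetaSymbol t ξ = zetaSymbol (s + t) ξ := by
  unfold zetaSymbol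
  split_ifs with h
  · have h0 : (ξ : ℂ) ≠ 0 := by
      have : ξ ≠ 0 := by linarith
      exact_mod_cast this
    rw [neg_add, Complex.cpow_add _ _ h0]
  · simp

/-- The tensor algebra `T(A)` of the algebra `A = ⨁_s ℂ σ_s` with `σ_s σ_t = σ_{s+t}`, by means of
its basis: the word `[s₁, …, s_k]` stands for the tensor `σ_{s₁} ⊗ ⋯ ⊗ σ_{s_k}`. -/
abbrev SymbolTensor : Type := List ℂ →₀ ℂ

/-- The basis tensor `σ_{s₁} ⊗ ⋯ ⊗ σ_{s_k}`. -/
noncomputable def symbolWord (w : List ℂ) : SymbolTensor := Finsupp.single w 1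

/-! ### Cut-off nested sums -/

/-- `strictNestedSum [s₁, …, s_k] N` is the sum of `σ_{s₁}(n₁) ⋯ σ_{s_k}(n_k)` over all
`0 ≤ n_k < ⋯ < n₁ < N`. -/
noncomputable def strictNestedSum : List ℂ → ℕ → ℂ
  | [], _ => 1
  | s :: w, N => ∑ n ∈ Finset.range N, zetaSymbol s (n : ℝ) * strictNestedSum w n

/-- `c` is the constant term in an asymptotic expansion of `u N`, as `N → ∞`, in the functions
`N ^ α * (log N) ^ l` with `α ∈ ℂ` and `l ∈ ℕ`. -/
def HasFinitePart (u : ℕ → ℂ) (c : ℂ) : Prop :=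
  ∃ (S : Finset (ℂ × ℕ)) (b : ℂ × ℕ → ℂ), (0, 0) ∉ S ∧
    Tendsto (fun N : ℕ =>
      u N - (c + ∑ p ∈ S, b p * (N : ℂ) ^ p.1 * ((Real.log (N : ℝ) : ℝ) : ℂ) ^ p.2))
      atTop (𝓝 0)

open Classical in
/-- The finite part of `u N` as `N → ∞`. -/
noncomputable def finitePart (u : ℕ → ℂ) : ℂ :=
  if h : ∃ c, HasFinitePart u c then h.choose else 0

/-- The partial sums (over `n₁ ≤ N`) whose finite part is the cut-off nested sum. -/
noncomputable def chenPartialSum (w : List ℂ) (N : ℕ) : ℂ := strictNestedSum w (N + 1)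

/-- The cut-off nested sum, as a linear form on the tensor algebra. -/
noncomputable def cutoffChenSum : SymbolTensor →ₗ[ℂ] ℂ :=
  Finsupp.linearCombination ℂ fun w => finitePart (chenPartialSum w)

/-- All the finite parts that enter the cut-off nested sum of `t` exist. -/
def CutoffChenSumDefined (t : SymbolTensor) : Prop :=
  ∀ w ∈ t.support, ∃ c, HasFinitePart (chenPartialSum w) c

/-! ### The twisted regularization -/

/-- The tensor `I[u]` in which the factors of `u` in each block of the composition `I` are
multiplied together. -/
def contractWord (u : List ℂ) (I : Composition u.length) : List ℂ :=
  (u.splitWrtComposition I).map List.sum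

/-- Hoffman's isomorphism `exp`. -/
noncomputable def hoffmanExp : SymbolTensor →ₗ[ℂ] SymbolTensor :=
  Finsupp.linearCombination ℂ fun u => ∑ I : Composition u.length,
    (1 / ((I.blocks.map fun i => (i.factorial : ℂ)).prod)) • symbolWord (contractWord u I)

/-- The inverse `log` of Hoffman's isomorphism. -/
noncomputable def hoffmanLog : SymbolTensor →ₗ[ℂ] SymbolTensor :=
  Finsupp.linearCombination ℂ fun u => ∑ I : Composition u.length,
    ((-1) ^ (u.length - I.length) / ((I.blocks.map fun i => (i : ℂ)).prod)) •
      symbolWord (contractWord u I)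

/-- The regularization `σ_s ↦ σ_{s+z}` in each tensor factor: a tensor of degree `m` uses the first
`m` of the variables `zs`. -/
noncomputable def tensorReg (zs : List ℂ) : SymbolTensor →ₗ[ℂ] SymbolTensor :=
  Finsupp.linearCombination ℂ fun u => symbolWord (List.zipWith (· + ·) u zs)

/-- The regularization twisted by Hoffman's isomorphism. -/
noncomputable def twistedReg (zs : List ℂ) : SymbolTensor →ₗ[ℂ] SymbolTensor :=
  hoffmanExp ∘ₗ tensorReg zs ∘ₗ hoffmanLog

/-- The regularized nested sum of `σ_{s₁} ⊗ ⋯ ⊗ σ_{s_k}`, as a function of `(z₁, …, z_k)`. -/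
noncomputable def regNestedSum (w : List ℂ) (zs : List ℂ) : ℂ :=
  cutoffChenSum (twistedReg zs (symbolWord w))

/-- The regularized nested sum restricted to the diagonal `z₁ = ⋯ = z_k = z`. -/
noncomputable def diagNestedSum (w : List ℂ) (z : ℂ) : ℂ :=
  regNestedSum w (List.replicate w.length z)

/-! ### Laurent series and evaluators -/

open Classical in
/-- The Laurent expansion at `0` of a function that is meromorphic at `0` (and `0` for any other
function): if `z ^ n * f z` is analytic at `0`, it is `z ^ (-n)` times the Taylor series of
`z ^ n * f z`. -/
noncomputable def laurentGerm (f : ℂ → ℂ) : LaurentSeries ℂ :=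
  if h : MeromorphicAt f 0 then
    HahnSeries.single (-(h.choose : ℤ)) (1 : ℂ) *
      HahnSeries.ofPowerSeries ℤ ℂ (PowerSeries.mk fun k =>
        iteratedDeriv k (fun z => z ^ h.choose * f z) 0 / (k.factorial : ℂ))
  else 0

/-- The projection of a Laurent series onto its pole part. -/
noncomputable def polePart : LaurentSeries ℂ →ₗ[ℂ] LaurentSeries ℂ where
  toFun L :=
    { coeff := fun n => if n < 0 then L.coeff n else 0
      isPWO_support' := L.isPWO_support.mono (by
        intro n hn
        simp only [Function.mem_support, ne_eq, ite_eq_right_iff, not_forall] at hn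
        exact hn.2) }
  map_add' L M := by
    ext n
    by_cases h : n < 0 <;> simp [h]
  map_smul' c L := by
    ext n
    by_cases h : n < 0 <;> simp [h]

/-- The regularized evaluator at zero: remove the pole part, then evaluate at `0`. -/
noncomputable def evReg (f : ℂ → ℂ) : ℂ :=
  (laurentGerm f - polePart (laurentGerm f)).coeff 0

/-- The symmetrized renormalized evaluator at zero in two variables. -/
noncomputable def evRenSym (f : ℂ → ℂ → ℂ) : ℂ :=
  (1 / 2) * (evReg (fun z₂ => evReg fun z₁ => f z₁ z₂) + evReg (fun z₁ => evReg fun z₂ => f z₁ z₂))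

/-- Every evaluation in the definition of `evRenSym f` is made on a meromorphic germ. -/
def EvRenSymDefined (f : ℂ → ℂ → ℂ) : Prop :=
  (∀ᶠ z₂ in 𝓝[≠] (0 : ℂ), MeromorphicAt (fun z₁ => f z₁ z₂) 0) ∧
  MeromorphicAt (fun z₂ => evReg fun z₁ => f z₁ z₂) 0 ∧
  (∀ᶠ z₁ in 𝓝[≠] (0 : ℂ), MeromorphicAt (fun z₂ => f z₁ z₂) 0) ∧
  MeromorphicAt (fun z₁ => evReg fun z₂ => f z₁ z₂) 0

/-- The double zeta value renormalized by the symmetrized evaluator. -/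
noncomputable def zetaEv (s₁ s₂ : ℂ) : ℂ :=
  evRenSym fun z₁ z₂ => regNestedSum [s₁, s₂] [z₁, z₂]

/-! ### Algebraic Birkhoff decomposition -/

/-- The convolution product `f ⋆ g` of two linear maps for the deconcatenation coproduct
`Δ (σ_{s₁} ⊗ ⋯ ⊗ σ_{s_k}) = ∑_j (σ_{s₁} ⊗ ⋯ ⊗ σ_{s_j}) ⊗ (σ_{s_{j+1}} ⊗ ⋯ ⊗ σ_{s_k})`. -/
noncomputable def convolution (f g : SymbolTensor →ₗ[ℂ] LaurentSeries ℂ) :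
    SymbolTensor →ₗ[ℂ] LaurentSeries ℂ :=
  Finsupp.linearCombination ℂ fun w => ∑ j ∈ Finset.range (w.length + 1),
    f (symbolWord (w.take j)) * g (symbolWord (w.drop j))

/-- The counit: the coefficient of the empty word. -/
noncomputable def wordCounit : SymbolTensor →ₗ[ℂ] ℂ := Finsupp.lapply []

/-- The unit for the convolution product: the counit followed by the unit of the algebra of Laurent
series. -/
noncomputable def convolutionUnit : SymbolTensor →ₗ[ℂ] LaurentSeries ℂ :=
  wordCounit.smulRight (1 : LaurentSeries ℂ)

/-- `φ = φm ^ (⋆ -1) ⋆ φp` where `φm` and `φp` map the unit to `1`, `φm` maps the kernel of the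
counit to pole parts, and `φp` maps it to power series. -/
def IsBirkhoffDecomposition (φ φm φp : SymbolTensor →ₗ[ℂ] LaurentSeries ℂ) : Prop :=
  φm (symbolWord []) = 1 ∧ φp (symbolWord []) = 1 ∧
  (∀ x, wordCounit x = 0 → φm x ∈ LinearMap.range polePart) ∧
  (∀ x, wordCounit x = 0 → φp x ∈ LinearMap.range (LinearMap.id - polePart)) ∧
  ∃ χ : SymbolTensor →ₗ[ℂ] LaurentSeries ℂ,
    convolution χ φm = convolutionUnit ∧ convolution φm χ = convolutionUnit ∧
    φ = convolution χ φp

/-- The map that sends `σ_{s₁} ⊗ ⋯ ⊗ σ_{s_k}` to the Laurent series at `z = 0` of its regularized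
nested sum on the diagonal. -/
noncomputable def diagNestedSumLaurent : SymbolTensor →ₗ[ℂ] LaurentSeries ℂ :=
  Finsupp.linearCombination ℂ fun w => laurentGerm (diagNestedSum w)

/-! The Euler-Maclaurin formula expands the inner sum over `n₂ < n` as `ζ(s₂) + ∑ⱼ cⱼ(s₂) n ^ (1 -
s₂ - j)` plus a remainder. Inserting this in the outer sum gives, away from the excluded exponents,
the finite part of the double sum: `ζ(s₁)ζ(s₂) + ∑ⱼ cⱼ(s₂) ζ(s₁ + s₂ - 1 + j)` plus a convergent
series (`hasFinitePart_pair`).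

At `sᵢ = -aᵢ + zᵢ` with small `zᵢ`, the pole of zeta is met only at `j = a₁ + a₂ + 2`, where its
argument is `1 + z₁ + z₂`. The coefficient `cⱼ` at this index has a factor `z₂`
(`emCoeff_eq_mul_polarCoeff`). So the only singular contribution behaves like `p · z₂ / (z₁ + z₂)`,
with `p` a value of `polarCoeff` (`regNestedSum_neg_natCast`). Evaluating `z₁` first gives `p`,
evaluating `z₂` first gives `0`, and their mean is `p / 2`. On the diagonal `z / (2 z) = 1 / 2`
gives `p / 2` again. Both renormalizations therefore add the same half to the value of the regular
part at the origin. There the Hoffman corrections cancel, the remainder vanishes because a power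
with exponent in `ℕ` is a polynomial, and zeta at nonpositive integers supplies the Bernoulli
numbers.

For the Birkhoff side, existence and uniqueness follow from recursion on word length. A one-letter
word at a nonpositive integer has no pole, so its counterterm is zero and the constant term of `ψ₊`
on the pair is that of `ψ`.

Finite parts are unambiguous because an expansion in `N ^ α * log ^ l N` tending to zero has zero
constant term (`eq_zero_of_tendsto_log_expansion`). -/

/-! ### Convolution of functions on words -/

section WordConvolution

variable {α A : Type*} [CommRing A]

/-- The convolution of two functions on words for the deconcatenation coproduct. -/
def wordConv (f g : List α → A) (w : List α) : A :=
  ∑ j ∈ Finset.range (w.length + 1), f (w.take j) * g (w.drop j)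

/-- The unit for `wordConv`. -/
def wordOne : List α → A
  | [] => 1
  | _ :: _ => 0

@[simp] theorem wordConv_nil (f g : List α → A) : wordConv f g [] = f [] * g [] := by
  simp [wordConv]

/-- Isolating the empty prefix turns convolution into a recursion on the tail, with the first letter
absorbed into the left factor; the inductions below generalize that factor. -/
theorem wordConv_cons (f g : List α → A) (a : α) (w : List α) :
    wordConv f g (a :: w) = f [] * g (a :: w) + wordConv (fun v => f (a :: v)) g w := by
  simp only [wordConv, List.length_cons]
  rw [Finset.sum_range_succ', add_comm]
  simp

theorem wordConv_add_left (f f' g : List α → A) (w : List α) :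
    wordConv (fun v => f v + f' v) g w = wordConv f g w + wordConv f' g w := by
  simp [wordConv, add_mul, Finset.sum_add_distrib]

theorem wordConv_mul_left (c : A) (f g : List α → A) (w : List α) :
    wordConv (fun v => c * f v) g w = c * wordConv f g w := by
  simp [wordConv, mul_assoc, Finset.mul_sum]

theorem wordConv_assoc (f g h : List α → A) :
    wordConv (wordConv f g) h = wordConv f (wordConv g h) := by
  funext w
  induction w generalizing f with
  | nil => simp [mul_assoc]
  | cons a w ih =>
    rw [wordConv_cons, wordConv_cons f]
    simp only [wordConv_cons f g]
    rw [wordConv_add_left, wordConv_mul_left, ih, wordConv_nil, wordConv_cons g h]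
    ring

theorem wordConv_zero_left (f : List α → A) (w : List α) : wordConv (fun _ => 0) f w = 0 := by
  simp [wordConv]

theorem wordOne_conv (f : List α → A) : wordConv wordOne f = f := by
  funext w
  cases w with
  | nil => simp [wordOne]
  | cons a w => rw [wordConv_cons]; simp [wordOne, wordConv_zero_left]

theorem conv_wordOne (f : List α → A) : wordConv f wordOne = f := by
  funext w
  induction w generalizing f with
  | nil => simp [wordOne]
  | cons a w ih => rw [wordConv_cons, ih]; simp [wordOne]

/-- The unital function `g` on words whose value at a nonempty word `w` is the opposite of `P`
applied to the part of `(g ⋆ f) w` that involves only proper prefixes of `w`. -/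
def bogoliubov (P : A → A) (f : List α → A) (w : List α) : A :=
  if w.length = 0 then 1 else
    -P (∑ j : Fin w.length, bogoliubov P f (w.take j) * f (w.drop j))
termination_by w.length
decreasing_by simp

@[simp] theorem bogoliubov_nil (P : A → A) (f : List α → A) : bogoliubov P f [] = 1 := by
  rw [bogoliubov]; simp

/-- The part of `(g ⋆ f) w` that involves only proper prefixes of `w`. -/
def properConv (g f : List α → A) (w : List α) : A :=
  ∑ j ∈ Finset.range w.length, g (w.take j) * f (w.drop j)

theorem bogoliubov_of_ne_nil (P : A → A) (f : List α → A) {w : List α} (hw : w ≠ []) :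
    bogoliubov P f w = -P (properConv (bogoliubov P f) f w) := by
  rw [bogoliubov, if_neg (by simpa using hw), properConv, Finset.sum_range]

/-- Unitality makes convolution triangular: `g w` enters only through the full prefix, with
coefficient `f [] = 1`. -/
theorem wordConv_eq_properConv_add {f : List α → A} (hf : f [] = 1) (g : List α → A)
    (w : List α) : wordConv g f w = properConv g f w + g w := by
  simp [wordConv, properConv, Finset.sum_range_succ, hf]

theorem bogoliubov_id_conv {f : List α → A} (hf : f [] = 1) :
    wordConv (bogoliubov id f) f = wordOne := by
  funext w
  rw [wordConv_eq_properConv_add hf]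
  cases w with
  | nil => simp [properConv, wordOne]
  | cons a w => rw [bogoliubov_of_ne_nil id f (List.cons_ne_nil a w)]; simp [wordOne]

/-- The left inverse of `f` itself has a left inverse; associativity identifies the latter with `f`,
so the inverse is two-sided. -/
theorem conv_bogoliubov_id {f : List α → A} (hf : f [] = 1) :
    wordConv f (bogoliubov id f) = wordOne := by
  have h1 := bogoliubov_id_conv hf
  have h2 := bogoliubov_id_conv (bogoliubov_nil id f)
  have h3 : bogoliubov id (bogoliubov id f) = f := by
    rw [← conv_wordOne (bogoliubov id (bogoliubov id f)), ← h1, ← wordConv_assoc, h2, wordOne_conv]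
  rwa [h3] at h2

/-- Two unital functions `g` on words for which `g ⋆ f` is annihilated by an additive `P` on nonempty
words coincide if `P` fixes their values on nonempty words. -/
theorem wordConv_left_unique (P : A → A) (hP : ∀ x y, P (x + y) = P x + P y)
    {f g g' : List α → A} (hf : f [] = 1) (hg : g [] = 1) (hg' : g' [] = 1)
    (h1 : ∀ w ≠ [], P (g w) = g w) (h1' : ∀ w ≠ [], P (g' w) = g' w)
    (h2 : ∀ w ≠ [], P (wordConv g f w) = 0) (h2' : ∀ w ≠ [], P (wordConv g' f w) = 0) :
    g = g' := by
  -- If `g` and `g'` agree on shorter words, their proper parts at `w` coincide, and applying `P`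
  -- forces both values to be minus `P` of that common part.
  have key : ∀ n : ℕ, ∀ w : List α, w.length = n → g w = g' w := by
    intro n
    induction n using Nat.strong_induction_on with
    | _ n ih =>
      intro w hw
      by_cases h0 : w = []
      · rw [h0, hg, hg']
      have e : properConv g f w = properConv g' f w := by
        refine Finset.sum_congr rfl fun j hj => ?_
        rw [Finset.mem_range] at hj
        rw [ih j (hw ▸ hj) (w.take j) (by simp [hj.le])]
      have a := h2 w h0
      have b := h2' w h0
      rw [wordConv_eq_properConv_add hf, hP, h1 w h0] at a
      rw [wordConv_eq_properConv_add hf, hP, h1' w h0, ← e] at b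
      exact add_left_cancel (a.trans b.symm)
  exact funext fun w => key _ w rfl

end WordConvolution

/-! ### Algebraic Birkhoff decomposition -/

/-- The values of a linear map on the basis tensors. -/
noncomputable def wordValues (f : SymbolTensor →ₗ[ℂ] LaurentSeries ℂ) (w : List ℂ) :
    LaurentSeries ℂ := f (symbolWord w)

/-- The linear map with given values on the basis tensors. -/
noncomputable def ofWordValues (f : List ℂ → LaurentSeries ℂ) :
    SymbolTensor →ₗ[ℂ] LaurentSeries ℂ := Finsupp.linearCombination ℂ f

@[simp] theorem linearCombination_symbolWord {M : Type*} [AddCommGroup M] [Module ℂ M]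
    (f : List ℂ → M) (w : List ℂ) : Finsupp.linearCombination ℂ f (symbolWord w) = f w := by
  simp [symbolWord]

@[simp] theorem wordValues_ofWordValues (f : List ℂ → LaurentSeries ℂ) :
    wordValues (ofWordValues f) = f := by
  funext w; simp [wordValues, ofWordValues]

theorem wordValues_injective : Function.Injective wordValues := by
  intro f g h
  refine Finsupp.lhom_ext' fun w => LinearMap.ext_ring ?_
  exact congrFun h w

theorem wordValues_convolution (f g : SymbolTensor →ₗ[ℂ] LaurentSeries ℂ) :
    wordValues (convolution f g) = wordConv (wordValues f) (wordValues g) := by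
  funext w
  simp [wordValues, convolution, wordConv]

theorem wordValues_convolutionUnit : wordValues convolutionUnit = wordOne := by
  funext w
  cases w <;> simp [wordValues, convolutionUnit, wordCounit, symbolWord, wordOne]

theorem polePart_coeff (L : LaurentSeries ℂ) (n : ℤ) :
    (polePart L).coeff n = if n < 0 then L.coeff n else 0 := rfl

theorem polePart_polePart (L : LaurentSeries ℂ) : polePart (polePart L) = polePart L := by
  ext n
  simp only [polePart_coeff]
  split_ifs <;> rfl

theorem mem_range_polePart {L : LaurentSeries ℂ} :
    L ∈ LinearMap.range polePart ↔ polePart L = L := by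
  constructor
  · rintro ⟨M, rfl⟩
    exact polePart_polePart M
  · exact fun h => ⟨L, h⟩

theorem mem_range_id_sub_polePart {L : LaurentSeries ℂ} :
    L ∈ LinearMap.range (LinearMap.id - polePart) ↔ polePart L = 0 := by
  constructor
  · rintro ⟨M, rfl⟩
    simp [polePart_polePart]
  · exact fun h => ⟨L, by simp [h]⟩

/-- The kernel of the counit is spanned by the nonempty words. -/
theorem forall_counit_eq_zero_mem (f : SymbolTensor →ₗ[ℂ] LaurentSeries ℂ)
    (V : Submodule ℂ (LaurentSeries ℂ)) :
    (∀ x, wordCounit x = 0 → f x ∈ V) ↔ ∀ w ≠ [], wordValues f w ∈ V := by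
  constructor
  · intro h w hw
    refine h _ ?_
    simp [wordCounit, symbolWord, hw]
  · intro h x hx
    have hx' : x [] = 0 := hx
    rw [← Finsupp.sum_single x, Finsupp.sum, map_sum]
    refine V.sum_mem fun w hw => ?_
    have hne : w ≠ [] := by
      rintro rfl
      exact (Finsupp.mem_support_iff.mp hw) hx'
    have : Finsupp.single w (x w) = x w • symbolWord w := by simp [symbolWord]
    rw [this, map_smul]
    exact V.smul_mem _ (h w hne)

/-- A Birkhoff decomposition in terms of the values on the basis tensors. -/
theorem isBirkhoffDecomposition_iff {φ : SymbolTensor →ₗ[ℂ] LaurentSeries ℂ}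
    (φm φp : SymbolTensor →ₗ[ℂ] LaurentSeries ℂ) :
    IsBirkhoffDecomposition φ φm φp ↔
      wordValues φm [] = 1 ∧ wordValues φp [] = 1 ∧
      (∀ w ≠ [], polePart (wordValues φm w) = wordValues φm w) ∧
      (∀ w ≠ [], polePart (wordValues φp w) = 0) ∧
      wordConv (wordValues φm) (wordValues φ) = wordValues φp := by
  unfold IsBirkhoffDecomposition
  rw [forall_counit_eq_zero_mem, forall_counit_eq_zero_mem]
  simp only [mem_range_polePart, mem_range_id_sub_polePart]
  refine and_congr_right fun h1 => and_congr_right fun h2 => and_congr_right fun _ =>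
    and_congr_right fun _ => ?_
  constructor
  · rintro ⟨χ, -, hχ, rfl⟩
    rw [wordValues_convolution, ← wordConv_assoc, ← wordValues_convolution, hχ,
      wordValues_convolutionUnit, wordOne_conv]
  · intro h
    have h1' : wordValues φm [] = 1 := h1
    -- Unitality of `φm` alone supplies the convolution inverse `χ`, so no choice remains in the
    -- existential.
    refine ⟨ofWordValues (bogoliubov id (wordValues φm)), ?_, ?_, ?_⟩ <;>
      apply wordValues_injective
    · simp [wordValues_convolution, wordValues_convolutionUnit, bogoliubov_id_conv h1']
    · simp [wordValues_convolution, wordValues_convolutionUnit, conv_bogoliubov_id h1']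
    · rw [wordValues_convolution, ← h, ← wordConv_assoc, wordValues_ofWordValues,
        bogoliubov_id_conv h1', wordOne_conv]

/-- A unital linear map has exactly one algebraic Birkhoff decomposition. -/
theorem existsUnique_isBirkhoffDecomposition (φ : SymbolTensor →ₗ[ℂ] LaurentSeries ℂ)
    (hφ : φ (symbolWord []) = 1) :
    ∃! ψ : (SymbolTensor →ₗ[ℂ] LaurentSeries ℂ) × (SymbolTensor →ₗ[ℂ] LaurentSeries ℂ),
      IsBirkhoffDecomposition φ ψ.1 ψ.2 := by
  simp only [isBirkhoffDecomposition_iff]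
  have hφ' : wordValues φ [] = 1 := hφ
  refine ⟨(ofWordValues (bogoliubov polePart (wordValues φ)),
    ofWordValues (wordConv (bogoliubov polePart (wordValues φ)) (wordValues φ))), ?_, ?_⟩
  · simp only [wordValues_ofWordValues, bogoliubov_nil, wordConv_nil, hφ', mul_one, true_and,
      and_true]
    constructor
    · intro w hw
      rw [bogoliubov_of_ne_nil _ _ hw, map_neg, polePart_polePart]
    · intro w hw
      rw [wordConv_eq_properConv_add hφ', bogoliubov_of_ne_nil _ _ hw, map_add, map_neg,
        polePart_polePart, add_neg_cancel]
  · rintro ⟨φm, φp⟩ ⟨h1, -, h3, h4, h5⟩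
    have hm : wordValues φm = bogoliubov polePart (wordValues φ) := by
      refine wordConv_left_unique polePart (map_add polePart) hφ' h1 (bogoliubov_nil _ _) h3 ?_
        (fun w hw => h5 ▸ h4 w hw) ?_
      · intro w hw
        rw [bogoliubov_of_ne_nil _ _ hw, map_neg, polePart_polePart]
      · intro w hw
        rw [wordConv_eq_properConv_add hφ', bogoliubov_of_ne_nil _ _ hw, map_add, map_neg,
          polePart_polePart, add_neg_cancel]
    refine Prod.ext (wordValues_injective ?_) (wordValues_injective ?_)
    · simpa using hm
    · simp [← h5, hm]

/-- If the first letter has no pole part, then the constant term of the positive part of the Birkhoff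
decomposition at a word of length two is the constant term of the map that is decomposed. -/
theorem IsBirkhoffDecomposition.coeff_zero_pair {φ φm φp : SymbolTensor →ₗ[ℂ] LaurentSeries ℂ}
    (h : IsBirkhoffDecomposition φ φm φp) (hφ : φ (symbolWord []) = 1) (s t : ℂ)
    (hs : polePart (φ (symbolWord [s])) = 0) :
    (φp (symbolWord [s, t])).coeff 0 = (φ (symbolWord [s, t])).coeff 0 := by
  rw [isBirkhoffDecomposition_iff] at h
  obtain ⟨h1, -, h3, h4, h5⟩ := h
  have hφ' : wordValues φ [] = 1 := hφ
  -- On one letter `φp = φ + φm`. Taking pole parts leaves only `φm`, since the other two terms have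
  -- none.
  have hs' : wordValues φm [s] = 0 := by
    have e := congrArg polePart (congrFun h5 [s])
    rw [h4 _ (List.cons_ne_nil _ _), wordConv_cons, wordConv_nil, h1, hφ', one_mul, mul_one,
      map_add, h3 _ (List.cons_ne_nil _ _)] at e
    rw [← e]
    change wordValues φm [s] = polePart (φ (symbolWord [s])) + _
    rw [hs, zero_add]
  have hst : (wordValues φm [s, t]).coeff 0 = 0 := by
    rw [← h3 _ (List.cons_ne_nil _ _), polePart_coeff, if_neg (lt_irrefl _)]
  change (wordValues φp [s, t]).coeff 0 = (wordValues φ [s, t]).coeff 0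
  rw [← h5, wordConv_cons, wordConv_cons, wordConv_nil, h1, hs', hφ']
  simp [hst]

/-! ### Finite parts -/

section FinitePart

open Polynomial

/-- If all these powers were `1`, dividing those at `N + 1` and `N` would give `exp (δ * α) = 1`
with `δ ≤ 1 / N`. For `N > ‖α‖` this has `‖δ * α‖ < 1 < 2π`, forcing `δ * α = 0`. -/
theorem exists_natCast_cpow_ne_one {α : ℂ} (hα : α ≠ 0) : ∃ q : ℕ, 1 ≤ q ∧ (q : ℂ) ^ α ≠ 1 := by
  by_contra! h
  obtain ⟨N, hN⟩ := exists_nat_gt ‖α‖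
  have hN0 : 0 < (N : ℝ) := (norm_nonneg α).trans_lt hN
  have hN1 : 1 ≤ N := by exact_mod_cast hN0
  have hNc : (N : ℂ) ≠ 0 := by exact_mod_cast hN0.ne'
  have hNc' : ((N + 1 : ℕ) : ℂ) ≠ 0 := by exact_mod_cast N.succ_ne_zero
  set δ : ℝ := Real.log ((N + 1 : ℕ) : ℝ) - Real.log N with hδ
  have hδ' : δ = Real.log (1 + 1 / (N : ℝ)) := by
    rw [hδ, ← Real.log_div (by positivity) hN0.ne']
    congr 1
    push_cast
    field_simp
  have hδ0 : 0 < δ := by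
    rw [hδ']
    exact Real.log_pos (by simpa using hN0)
  have hδ1 : δ ≤ 1 / N := by
    rw [hδ']
    have := Real.log_le_sub_one_of_pos (show 0 < 1 + 1 / (N : ℝ) by positivity)
    linarith
  have e : Complex.exp (δ * α) = 1 := by
    have h1 := h (N + 1) (by omega)
    have h2 := h N hN1
    rw [Complex.cpow_def_of_ne_zero hNc', ← Complex.natCast_log] at h1
    rw [Complex.cpow_def_of_ne_zero hNc, ← Complex.natCast_log] at h2
    rw [hδ, Complex.ofReal_sub, sub_mul, Complex.exp_sub, h1, h2, div_one]
  obtain ⟨n, hn⟩ := Complex.exp_eq_one_iff.mp e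
  have hnorm : ‖(δ : ℂ) * α‖ < 1 := by
    rw [norm_mul, Complex.norm_real, Real.norm_of_nonneg hδ0.le]
    calc δ * ‖α‖ ≤ 1 / N * ‖α‖ := by gcongr
      _ < 1 / N * N := by gcongr
      _ = 1 := by field_simp
  have hn0 : n = 0 := by
    by_contra hne
    rw [hn] at hnorm
    have h1 : (1 : ℝ) ≤ ‖(n : ℂ)‖ := by
      rw [Complex.norm_intCast]
      exact_mod_cast Int.one_le_abs hne
    have h2 : ‖(2 * (Real.pi : ℂ) * Complex.I)‖ = 2 * Real.pi := by
      simp [abs_of_pos Real.pi_pos]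
    rw [norm_mul, h2] at hnorm
    nlinarith [Real.pi_gt_three]
  rw [hn0] at hn
  have : (δ : ℂ) ≠ 0 := by exact_mod_cast hδ0.ne'
  simp [this, hα] at hn

/-- The degree plus one, or zero for the zero polynomial. -/
noncomputable def degreeSize (p : ℂ[X]) : ℕ := if p = 0 then 0 else p.natDegree + 1

theorem degreeSize_le {p q : ℂ[X]} (h : p.degree ≤ q.degree) : degreeSize p ≤ degreeSize q := by
  unfold degreeSize
  split_ifs with hp hq hq
  · exact le_rfl
  · exact Nat.zero_le _
  · rw [hq, degree_zero, le_bot_iff, degree_eq_bot] at h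
    exact absurd h hp
  · exact Nat.succ_le_succ (natDegree_le_natDegree h)

theorem degreeSize_lt {p q : ℂ[X]} (h : p.degree < q.degree) : degreeSize p < degreeSize q := by
  have hq : q ≠ 0 := ne_zero_of_degree_gt h
  unfold degreeSize
  rw [if_neg hq]
  split_ifs with hp
  · exact Nat.succ_pos _
  · exact Nat.succ_lt_succ (natDegree_lt_natDegree hp h)

theorem tendsto_log_natCast_norm :
    Tendsto (fun N : ℕ => ‖((Real.log (N : ℝ) : ℝ) : ℂ)‖) atTop atTop := by
  refine tendsto_atTop_mono (fun N => ?_)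
    (Real.tendsto_log_atTop.comp tendsto_natCast_atTop_atTop)
  rw [Complex.norm_real]
  exact Real.le_norm_self _

/-- Finite differences under dilation: replacing `u N` by `u (q N) - q ^ α * u N` preserves the
shape of the expansion and lowers the degree of the log polynomial attached to `N ^ α`. The
induction is on the total size of these polynomials, down to a polynomial in `log N` alone. -/
theorem eq_zero_of_tendsto_log_expansion (n : ℕ) : ∀ (A : Finset ℂ) (P : ℂ → ℂ[X]) (Q : ℂ[X]),
    0 ∉ A → ∑ α ∈ A, degreeSize (P α) ≤ n →
    Tendsto (fun N : ℕ => Q.eval ((Real.log (N : ℝ) : ℝ) : ℂ) +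
      ∑ α ∈ A, (N : ℂ) ^ α * (P α).eval ((Real.log (N : ℝ) : ℝ) : ℂ)) atTop (𝓝 0) →
    Q = 0 := by
  induction n with
  | zero =>
    intro A P Q hA hn h
    have hP : ∀ α ∈ A, P α = 0 := by
      intro α hα
      by_contra hne
      have := (Finset.sum_eq_zero_iff.mp (Nat.le_zero.mp hn)) α hα
      simp [degreeSize, hne] at this
    have h' : Tendsto (fun N : ℕ => Q.eval ((Real.log (N : ℝ) : ℝ) : ℂ)) atTop (𝓝 0) := by
      refine h.congr fun N => ?_
      rw [Finset.sum_eq_zero fun α hα => by simp [hP α hα], add_zero]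
    by_cases hd : 0 < Q.degree
    · exact absurd h'.norm
        (not_tendsto_nhds_of_tendsto_atTop (Q.tendsto_norm_atTop hd tendsto_log_natCast_norm) _)
    · rw [eq_C_of_degree_le_zero (not_lt.mp hd)] at h' ⊢
      simp only [eval_C] at h'
      rw [tendsto_nhds_unique tendsto_const_nhds h', C_0]
  | succ n ih =>
    intro A P Q hA hn h
    by_cases hP : ∀ α ∈ A, P α = 0
    · refine ih A P Q hA ?_ h
      rw [Finset.sum_eq_zero fun α hα => by simp [degreeSize, hP α hα]]
      exact Nat.zero_le _
    push Not at hP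
    obtain ⟨α, hα, hPα⟩ := hP
    obtain ⟨q, hq, hqα⟩ := exists_natCast_cpow_ne_one (ne_of_mem_of_not_mem hα hA)
    have hq0 : (q : ℂ) ≠ 0 := by exact_mod_cast (by omega : q ≠ 0)
    set r : ℂ := ((Real.log (q : ℝ) : ℝ) : ℂ) with hr
    set c : ℂ := (q : ℂ) ^ α with hc
    have hc0 : c ≠ 0 := by simp [hc, Complex.cpow_eq_zero_iff, hq0]
    -- Dilation by `q` shifts `log N` by `r = log q`. A shift preserves degree and leading
    -- coefficient, so at `α` the leading terms cancel, while at the other exponents the degree does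
    -- not grow.
    have key : taylor r Q - C c * Q = 0 := by
      refine ih A (fun β => C ((q : ℂ) ^ β) * taylor r (P β) - C c * P β) _ hA ?_ ?_
      · rw [← Nat.lt_succ_iff]
        refine lt_of_lt_of_le (Finset.sum_lt_sum (fun β _ => degreeSize_le ?_) ⟨α, hα, ?_⟩) hn
        · refine (degree_sub_le _ _).trans (max_le ?_ ?_)
          · rw [degree_C_mul (by simp [Complex.cpow_eq_zero_iff, hq0]), degree_taylor]
          · rw [degree_C_mul hc0]
        · refine degreeSize_lt ?_
          rw [← mul_sub, degree_C_mul hc0]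
          exact degree_sub_lt_right (degree_taylor _ _) hPα (leadingCoeff_taylor _ _)
      · have h1 : Tendsto (fun N : ℕ => q * N) atTop atTop :=
          tendsto_id.const_mul_atTop' (by omega)
        have h2 := (h.comp h1).sub (h.const_mul c)
        rw [mul_zero, sub_zero] at h2
        refine h2.congr' ?_
        filter_upwards [eventually_ge_atTop 1] with N hN
        have hlog : ((Real.log ((q : ℝ) * N) : ℝ) : ℂ) = ((Real.log (N : ℝ) : ℝ) : ℂ) + r := by
          rw [Real.log_mul (by positivity) (by positivity), Complex.ofReal_add,
            add_comm]
        simp only [Function.comp_apply, eval_sub, eval_mul, eval_C, taylor_eval, mul_add,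
          Finset.mul_sum, Nat.cast_mul, hlog, Complex.natCast_mul_natCast_cpow, mul_sub,
          Finset.sum_sub_distrib]
        have e1 : ∀ β, (N : ℂ) ^ β * ((q : ℂ) ^ β * (P β).eval (((Real.log (N : ℝ) : ℝ) : ℂ) + r)) =
          (q : ℂ) ^ β * (N : ℂ) ^ β * (P β).eval (((Real.log (N : ℝ) : ℝ) : ℂ) + r) :=
            fun β => by ring
        have e2 : ∀ β, (N : ℂ) ^ β * (c * (P β).eval ((Real.log (N : ℝ) : ℝ) : ℂ)) =
          c * ((N : ℂ) ^ β * (P β).eval ((Real.log (N : ℝ) : ℝ) : ℂ)) := fun β => by ring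
        simp only [e1, e2]
        ring
    -- Comparing leading coefficients, a nonzero `Q` would give `q ^ α = 1`, contrary to the choice
    -- of `q`.
    have hl := congrArg leadingCoeff (sub_eq_zero.mp key)
    rw [leadingCoeff_taylor, leadingCoeff_mul, leadingCoeff_C] at hl
    rw [← leadingCoeff_eq_zero]
    by_contra hne
    exact hqα (mul_right_cancel₀ hne (by rw [one_mul, ← hl]))

/-! ### Linearity and uniqueness of finite parts -/

theorem HasFinitePart.add {u v : ℕ → ℂ} {c d : ℂ} (hu : HasFinitePart u c)
    (hv : HasFinitePart v d) : HasFinitePart (fun N => u N + v N) (c + d) := by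
  classical
  obtain ⟨S, b, hS, h⟩ := hu
  obtain ⟨S', b', hS', h'⟩ := hv
  refine ⟨S ∪ S', fun p => (if p ∈ S then b p else 0) + (if p ∈ S' then b' p else 0),
    by simp [hS, hS'], ?_⟩
  have := h.add h'
  rw [add_zero] at this
  refine this.congr fun N => ?_
  have e1 : ∑ p ∈ S ∪ S', (if p ∈ S then b p else 0) * (N : ℂ) ^ p.1 *
      ((Real.log (N : ℝ) : ℝ) : ℂ) ^ p.2 =
      ∑ p ∈ S, b p * (N : ℂ) ^ p.1 * ((Real.log (N : ℝ) : ℝ) : ℂ) ^ p.2 := by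
    rw [← Finset.sum_subset Finset.subset_union_left
      (fun p _ hp => by rw [if_neg hp, zero_mul, zero_mul])]
    exact Finset.sum_congr rfl fun p hp => by rw [if_pos hp]
  have e2 : ∑ p ∈ S ∪ S', (if p ∈ S' then b' p else 0) * (N : ℂ) ^ p.1 *
      ((Real.log (N : ℝ) : ℝ) : ℂ) ^ p.2 =
      ∑ p ∈ S', b' p * (N : ℂ) ^ p.1 * ((Real.log (N : ℝ) : ℝ) : ℂ) ^ p.2 := by
    rw [← Finset.sum_subset Finset.subset_union_right
      (fun p _ hp => by rw [if_neg hp, zero_mul, zero_mul])]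
    exact Finset.sum_congr rfl fun p hp => by rw [if_pos hp]
  simp only [add_mul, Finset.sum_add_distrib, e1, e2]
  ring

theorem HasFinitePart.const_mul {u : ℕ → ℂ} {c : ℂ} (a : ℂ) (hu : HasFinitePart u c) :
    HasFinitePart (fun N => a * u N) (a * c) := by
  obtain ⟨S, b, hS, h⟩ := hu
  refine ⟨S, fun p => a * b p, hS, ?_⟩
  have := h.const_mul a
  rw [mul_zero] at this
  refine this.congr fun N => ?_
  simp only [mul_sub, mul_add, Finset.mul_sum, mul_assoc]

theorem HasFinitePart.of_tendsto {u : ℕ → ℂ} {c : ℂ} (h : Tendsto u atTop (𝓝 c)) :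
    HasFinitePart u c := by
  refine ⟨∅, 0, by simp, ?_⟩
  simpa using h.sub_const c

theorem HasFinitePart.congr' {u v : ℕ → ℂ} {c : ℂ} (h : HasFinitePart u c)
    (huv : u =ᶠ[atTop] v) : HasFinitePart v c := by
  obtain ⟨S, b, hS, h⟩ := h
  exact ⟨S, b, hS, h.congr' (huv.mono fun N hN => by simp only [hN])⟩

theorem hasFinitePart_cpow {α : ℂ} (hα : α ≠ 0) : HasFinitePart (fun N => (N : ℂ) ^ α) 0 := by
  refine ⟨{(α, 0)}, 1, by simp [Ne.symm hα], ?_⟩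
  simp

theorem HasFinitePart.sum {ι : Type*} (s : Finset ι) {u : ι → ℕ → ℂ} {c : ι → ℂ}
    (h : ∀ i ∈ s, HasFinitePart (u i) (c i)) :
    HasFinitePart (fun N => ∑ i ∈ s, u i N) (∑ i ∈ s, c i) := by
  classical
  induction s using Finset.induction_on with
  | empty => simpa using HasFinitePart.of_tendsto (tendsto_const_nhds (x := (0 : ℂ)))
  | insert i s hi ih =>
    simp only [Finset.sum_insert hi]
    exact (h i (Finset.mem_insert_self i s)).add
      (ih fun j hj => h j (Finset.mem_insert_of_mem hj))

/-- After grouping by the exponent of `N`, the exponent `0` carries a polynomial in `log N`. Its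
constant coefficient is exactly `c`, because `(0, 0)` is excluded from the other terms. -/
theorem eq_zero_of_hasFinitePart_zero {c : ℂ} (h : HasFinitePart (fun _ => 0) c) : c = 0 := by
  classical
  obtain ⟨S, b, hS, h⟩ := h
  set P : ℂ → ℂ[X] := fun α => ∑ p ∈ S with p.1 = α, C (b p) * X ^ p.2 with hP
  set B : Finset ℂ := (S.image Prod.fst).erase 0
  have hB : 0 ∉ B := Finset.notMem_erase _ _
  have key : C c + P 0 = 0 := by
    refine eq_zero_of_tendsto_log_expansion _ B P _ hB le_rfl ?_
    have h' := h.neg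
    rw [neg_zero] at h'
    refine h'.congr fun N => ?_
    have hmaps : ∀ p ∈ S, p.1 ∈ insert 0 B := by
      intro p hp
      by_cases h0 : p.1 = 0
      · simp [h0]
      · simp only [B, Finset.mem_insert, Finset.mem_erase, Finset.mem_image]
        exact Or.inr ⟨h0, p, hp, rfl⟩
    rw [zero_sub, neg_neg, ← Finset.sum_fiberwise_of_maps_to hmaps, Finset.sum_insert hB, eval_add,
      eval_C, add_assoc]
    have e : ∀ α, ∑ p ∈ S with p.1 = α, b p * (N : ℂ) ^ p.1 * ((Real.log (N : ℝ) : ℝ) : ℂ) ^ p.2 =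
        (N : ℂ) ^ α * (P α).eval ((Real.log (N : ℝ) : ℝ) : ℂ) := by
      intro α
      rw [hP, eval_finsetSum, Finset.mul_sum]
      refine Finset.sum_congr rfl fun p hp => ?_
      rw [(Finset.mem_filter.mp hp).2]
      simp only [eval_mul, eval_C, eval_pow, eval_X]
      ring
    simp only [e, Complex.cpow_zero, one_mul]
  have h0 := congrArg (fun p => coeff p 0) key
  have hP0 : (P 0).coeff 0 = 0 := by
    rw [hP, finsetSum_coeff]
    refine Finset.sum_eq_zero fun p hp => ?_
    rw [Finset.mem_filter] at hp
    have : p.2 ≠ 0 := fun h2 => hS (by rw [← hp.2, ← h2]; exact hp.1)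
    rw [coeff_C_mul, coeff_X_pow, if_neg (Ne.symm this), mul_zero]
  simpa [hP0] using h0

theorem HasFinitePart.unique {u : ℕ → ℂ} {c d : ℂ} (h : HasFinitePart u c)
    (h' : HasFinitePart u d) : c = d := by
  have := h.add (h'.const_mul (-1))
  simp only [neg_mul, one_mul, add_neg_cancel] at this
  exact add_neg_eq_zero.mp (eq_zero_of_hasFinitePart_zero this)

theorem HasFinitePart.finitePart_eq {u : ℕ → ℂ} {c : ℂ} (h : HasFinitePart u c) :
    finitePart u = c := by
  have hex : ∃ c, HasFinitePart u c := ⟨c, h⟩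
  rw [finitePart, dif_pos hex]
  exact hex.choose_spec.unique h

end FinitePart

/-! ### Laurent germs of functions with a removable singularity -/

/-- The power of `z` chosen in `laurentGerm` is immaterial: multiplication by `z ^ n` shifts the
Taylor coefficients by `n`, which the factor `single (-n)` undoes. -/
theorem laurentGerm_eq_taylor {f g : ℂ → ℂ} (hg : AnalyticAt ℂ g 0) (h : f =ᶠ[𝓝[≠] 0] g) :
    laurentGerm f = HahnSeries.ofPowerSeries ℤ ℂ
      (PowerSeries.mk fun k => iteratedDeriv k g 0 / (k.factorial : ℂ)) := by
  have hf : MeromorphicAt f 0 := hg.meromorphicAt.congr h.symm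
  rw [laurentGerm, dif_pos hf]
  set n := hf.choose with hn
  have hF : AnalyticAt ℂ (fun z => z ^ n * f z) 0 := by
    have h1 : AnalyticAt ℂ (fun z => (z - 0) ^ n • f z) 0 := hf.choose_spec
    simpa using h1
  have hG : AnalyticAt ℂ (fun z => z ^ n * g z) 0 := by fun_prop
  -- Both sides are continuous at `0`, so agreement on the punctured neighbourhood extends to the
  -- point itself, where `f` was not controlled.
  have hFG : (fun z => z ^ n * f z) =ᶠ[𝓝 0] fun z => z ^ n * g z := by
    refine (hF.continuousAt.eventuallyEq_nhds_iff_eventuallyEq_nhdsNE hG.continuousAt).mp ?_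
    exact h.mono fun z hz => by simp only [hz]
  have hmk : (PowerSeries.mk fun k => iteratedDeriv k (fun z => z ^ n * f z) 0 /
      (k.factorial : ℂ)) =
      PowerSeries.X ^ n * PowerSeries.mk fun k => iteratedDeriv k g 0 / (k.factorial : ℂ) := by
    ext k
    rw [PowerSeries.coeff_X_pow_mul', PowerSeries.coeff_mk, hFG.iteratedDeriv_eq,
      iteratedDeriv_fun_mul (by fun_prop) hg.contDiffAt]
    simp only [iteratedDeriv_fun_pow_zero, Nat.cast_ite, Nat.cast_zero, mul_ite, mul_zero, ite_mul, zero_mul]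
    rw [Finset.sum_ite_eq']
    simp only [Finset.mem_range, Nat.lt_succ_iff]
    split_ifs with hk
    · rw [PowerSeries.coeff_mk, div_eq_div_iff (by exact_mod_cast k.factorial_ne_zero)
        (by exact_mod_cast (k - n).factorial_ne_zero), ← Nat.choose_mul_factorial_mul_factorial hk]
      push_cast
      ring
    · simp
  rw [hmk, map_mul, HahnSeries.ofPowerSeries_X_pow, ← mul_assoc, HahnSeries.single_mul_single]
  simp

theorem polePart_ofPowerSeries (p : PowerSeries ℂ) :
    polePart (HahnSeries.ofPowerSeries ℤ ℂ p) = 0 := by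
  ext n
  rw [polePart_coeff, HahnSeries.coeff_zero]
  split_ifs with h
  · rw [HahnSeries.ofPowerSeries_apply]
    refine HahnSeries.embDomain_of_notMem_range ?_
    rintro ⟨k, hk⟩
    simp at hk
    omega
  · rfl

theorem polePart_laurentGerm {f g : ℂ → ℂ} (hg : AnalyticAt ℂ g 0) (h : f =ᶠ[𝓝[≠] 0] g) :
    polePart (laurentGerm f) = 0 := by
  rw [laurentGerm_eq_taylor hg h, polePart_ofPowerSeries]

theorem coeff_zero_laurentGerm {f g : ℂ → ℂ} (hg : AnalyticAt ℂ g 0) (h : f =ᶠ[𝓝[≠] 0] g) :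
    (laurentGerm f).coeff 0 = g 0 := by
  rw [laurentGerm_eq_taylor hg h]
  have := HahnSeries.ofPowerSeries_apply_coeff (Γ := ℤ)
    (PowerSeries.mk fun k => iteratedDeriv k g 0 / (k.factorial : ℂ)) 0
  simpa using this

theorem evReg_eq {f g : ℂ → ℂ} (hg : AnalyticAt ℂ g 0) (h : f =ᶠ[𝓝[≠] 0] g) : evReg f = g 0 := by
  rw [evReg, polePart_laurentGerm hg h, sub_zero, coeff_zero_laurentGerm hg h]

theorem laurentGerm_one : laurentGerm (fun _ => 1) = 1 := by
  rw [laurentGerm_eq_taylor analyticAt_const (EventuallyEq.refl _ _)]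
  have : (PowerSeries.mk fun k => iteratedDeriv k (fun _ : ℂ => (1 : ℂ)) 0 / (k.factorial : ℂ)) =
      1 := by
    ext k
    rw [PowerSeries.coeff_mk, iteratedDeriv_const, PowerSeries.coeff_one]
    split_ifs with hk <;> simp [hk]
  rw [this, map_one]

/-! ### The Euler-Maclaurin formula for complex powers -/

/-- The polynomial `(-s) (-s - 1) ⋯ (-s - k + 1)`: the `k`-th derivative of `x ^ (-s)` is
`fallingNeg k s * x ^ (-s - k)`. -/
noncomputable def fallingNeg (k : ℕ) (s : ℂ) : ℂ := ∏ i ∈ Finset.range k, (-s - i)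

theorem fallingNeg_zero (s : ℂ) : fallingNeg 0 s = 1 := by simp [fallingNeg]

theorem fallingNeg_succ (k : ℕ) (s : ℂ) : fallingNeg (k + 1) s = fallingNeg k s * (-s - k) := by
  simp [fallingNeg, Finset.prod_range_succ]

theorem differentiable_fallingNeg (k : ℕ) : Differentiable ℂ (fallingNeg k) := by
  unfold fallingNeg
  fun_prop

theorem norm_fallingNeg_le (k : ℕ) {s : ℂ} {M : ℝ} (hs : ‖s‖ ≤ M) :
    ‖fallingNeg k s‖ ≤ (M + k) ^ k := by
  rw [fallingNeg, norm_prod]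
  refine (Finset.prod_le_prod (fun _ _ => norm_nonneg _) (g := fun _ => M + k)
    fun i hi => ?_).trans (by simp)
  refine (norm_sub_le _ _).trans ?_
  rw [norm_neg, Complex.norm_natCast]
  have : (i : ℝ) ≤ k := by exact_mod_cast (Finset.mem_range.mp hi).le
  linarith

/-- The coefficient of `n ^ (1 - s - j)` in the asymptotic expansion of `∑_{m < n} m ^ (-s)`. -/
noncomputable def emCoeff (s : ℂ) : ℕ → ℂ
  | 0 => 1 / (1 - s)
  | k + 1 => (bernoulli (k + 1) : ℂ) / ((k + 1).factorial : ℂ) * fallingNeg k s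

/-- The remainder in the Euler-Maclaurin formula of order `K` on `[m, m + 1]`. -/
noncomputable def emLocal (K : ℕ) (s : ℂ) (m : ℕ) : ℂ :=
  ∫ x in (0 : ℝ)..1, ((bernoulliFun K (1 - x) / (K.factorial : ℝ) : ℝ) : ℂ) *
    (fallingNeg K s * ((m + x : ℝ) : ℂ) ^ (-s - K))

theorem hasDerivAt_bernoulliFun_one_sub (k : ℕ) (x : ℝ) :
    HasDerivAt (fun x : ℝ => ((bernoulliFun (k + 1) (1 - x) / ((k + 1).factorial : ℝ) : ℝ) : ℂ))
      (-((bernoulliFun k (1 - x) / (k.factorial : ℝ) : ℝ) : ℂ)) x := by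
  have h := ((hasDerivAt_bernoulliFun (k + 1) (1 - x)).comp x
    ((hasDerivAt_id x).const_sub 1)).div_const ((k + 1).factorial : ℝ)
  refine HasDerivAt.congr_deriv h.ofReal_comp ?_
  rw [← Complex.ofReal_neg]
  congr 1
  rw [Nat.factorial_succ, Nat.add_sub_cancel]
  push_cast
  have : (k.factorial : ℝ) ≠ 0 := by exact_mod_cast k.factorial_ne_zero
  field_simp

theorem hasDerivAt_ofReal_add_cpow (c : ℂ) {m x : ℝ} (hx : 0 < m + x) :
    HasDerivAt (fun x : ℝ => ((m + x : ℝ) : ℂ) ^ c) (c * ((m + x : ℝ) : ℂ) ^ (c - 1)) x := by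
  have h := (((hasDerivAt_id (x : ℂ)).const_add (m : ℂ)).cpow_const (c := c)
    (Or.inl (by simpa using hx))).comp_ofReal
  simpa using h

theorem hasDerivAt_fallingNeg_mul_cpow (k : ℕ) (s : ℂ) {m x : ℝ} (hx : 0 < m + x) :
    HasDerivAt (fun x : ℝ => fallingNeg k s * ((m + x : ℝ) : ℂ) ^ (-s - k))
      (fallingNeg (k + 1) s * ((m + x : ℝ) : ℂ) ^ (-s - (k + 1 : ℕ))) x := by
  refine ((hasDerivAt_ofReal_add_cpow (-s - k) hx).const_mul (fallingNeg k s)).congr_deriv ?_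
  rw [fallingNeg_succ]
  push_cast
  rw [sub_sub (-s) (k : ℂ) 1]
  ring

theorem continuousOn_emLocal (K : ℕ) (a s : ℂ) (k : ℕ) {m : ℕ} (hm : 1 ≤ m) :
    ContinuousOn (fun x : ℝ => ((bernoulliFun k (1 - x) / (k.factorial : ℝ) : ℝ) : ℂ) *
      (a * ((m + x : ℝ) : ℂ) ^ (-s - K))) (Set.uIcc 0 1) := by
  have hm' : (1 : ℝ) ≤ m := by exact_mod_cast hm
  refine ContinuousOn.mul ?_ (continuousOn_const.mul ?_)
  · have := continuous_bernoulliFun k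
    fun_prop
  · refine ContinuousOn.cpow_const (by fun_prop) fun x hx => Or.inl ?_
    rw [Set.uIcc_of_le zero_le_one] at hx
    rw [Complex.ofReal_re]
    linarith [hx.1]

/-- Integration by parts. The exceptional `1` at `k = 0` comes from `B₁(1) = 1/2 = B₁ + 1`, and it
is this term that produces the summand `m ^ (-s)`. -/
theorem emLocal_succ (k : ℕ) (s : ℂ) {m : ℕ} (hm : 1 ≤ m) :
    emLocal (k + 1) s m = emLocal k s m +
      (bernoulli (k + 1) : ℂ) / ((k + 1).factorial : ℂ) *
        (fallingNeg k s * ((m + 1 : ℕ) : ℂ) ^ (-s - k)) -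
      ((bernoulli (k + 1) : ℂ) + if k = 0 then 1 else 0) / ((k + 1).factorial : ℂ) *
        (fallingNeg k s * (m : ℂ) ^ (-s - k)) := by
  have hm' : (1 : ℝ) ≤ m := by exact_mod_cast hm
  have hc1 := continuousOn_emLocal k (fallingNeg k s) s k hm
  have hc2 := continuousOn_emLocal (k + 1) (fallingNeg (k + 1) s) s (k + 1) hm
  have h := intervalIntegral.integral_eq_sub_of_hasDerivAt (a := (0 : ℝ)) (b := 1)
    (f := fun x : ℝ => ((bernoulliFun (k + 1) (1 - x) / ((k + 1).factorial : ℝ) : ℝ) : ℂ) *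
      (fallingNeg k s * ((m + x : ℝ) : ℂ) ^ (-s - k)))
    (f' := fun x : ℝ => -(((bernoulliFun k (1 - x) / (k.factorial : ℝ) : ℝ) : ℂ) *
      (fallingNeg k s * ((m + x : ℝ) : ℂ) ^ (-s - k))) +
      ((bernoulliFun (k + 1) (1 - x) / ((k + 1).factorial : ℝ) : ℝ) : ℂ) *
      (fallingNeg (k + 1) s * ((m + x : ℝ) : ℂ) ^ (-s - (k + 1 : ℕ)))) ?_ ?_
  · rw [intervalIntegral.integral_add hc1.fun_neg.intervalIntegrable hc2.intervalIntegrable,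
      intervalIntegral.integral_neg] at h
    change -emLocal k s m + emLocal (k + 1) s m = _ at h
    rw [neg_add_eq_sub, sub_eq_iff_eq_add'] at h
    rw [h, sub_self, sub_zero, bernoulliFun_eval_one, bernoulliFun_eval_zero, add_zero]
    simp only [Nat.add_eq_right, add_sub_assoc]
    push_cast
    split_ifs <;> simp
  · intro x hx
    rw [Set.uIcc_of_le zero_le_one] at hx
    refine ((hasDerivAt_bernoulliFun_one_sub k x).mul
      (hasDerivAt_fallingNeg_mul_cpow k s (m := m) (by linarith [hx.1]))).congr_deriv ?_
    ring
  · exact (hc1.neg.add hc2).intervalIntegrable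

theorem emLocal_zero {s : ℂ} (hs : s ≠ 1) {m : ℕ} (hm : 1 ≤ m) :
    emLocal 0 s m = 1 / (1 - s) * (((m + 1 : ℕ) : ℂ) ^ (1 - s) - (m : ℂ) ^ (1 - s)) := by
  have hm' : (1 : ℝ) ≤ m := by exact_mod_cast hm
  have hs' : 1 - s ≠ 0 := sub_ne_zero.mpr hs.symm
  have h := intervalIntegral.integral_eq_sub_of_hasDerivAt (a := (0 : ℝ)) (b := 1)
    (f := fun x : ℝ => 1 / (1 - s) * ((m + x : ℝ) : ℂ) ^ (1 - s))
    (f' := fun x : ℝ => ((m + x : ℝ) : ℂ) ^ (-s)) ?_ ?_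
  · have e : emLocal 0 s m = ∫ x in (0 : ℝ)..1, ((m + x : ℝ) : ℂ) ^ (-s) := by
      simp [emLocal, fallingNeg_zero]
    rw [e, h]
    push_cast
    simp only [add_zero]
    ring
  · intro x hx
    rw [Set.uIcc_of_le zero_le_one] at hx
    have hpos : 0 < (m : ℝ) + x := by linarith [hx.1]
    refine ((hasDerivAt_ofReal_add_cpow (1 - s) hpos).const_mul (1 / (1 - s))).congr_deriv ?_
    rw [show (1 : ℂ) - s - 1 = -s by ring]
    field_simp
  · have := continuousOn_emLocal 0 1 s 0 hm
    refine ContinuousOn.intervalIntegrable (this.congr fun x _ => ?_)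
    simp

/-- The Euler-Maclaurin formula on `[m, m + 1]`. -/
theorem natCast_cpow_neg_eq {K : ℕ} (hK : 1 ≤ K) {s : ℂ} (hs : s ≠ 1) {m : ℕ} (hm : 1 ≤ m) :
    (m : ℂ) ^ (-s) = ∑ j ∈ Finset.range (K + 1),
      emCoeff s j * (((m + 1 : ℕ) : ℂ) ^ (1 - s - j) - (m : ℂ) ^ (1 - s - j)) - emLocal K s m := by
  induction K, hK using Nat.le_induction with
  | base =>
    rw [emLocal_succ 0 s hm, emLocal_zero hs hm]
    simp [Finset.sum_range_succ, emCoeff, fallingNeg_zero]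
    ring
  | succ K hK ih =>
    rw [Finset.sum_range_succ, emLocal_succ K s hm, if_neg (by omega)]
    rw [eq_sub_iff_add_eq] at ih ⊢
    rw [← ih]
    simp only [emCoeff]
    have e : (1 : ℂ) - s - (K + 1 : ℕ) = -s - K := by push_cast; ring
    rw [e]
    ring

/-! ### Bounds and holomorphy of the remainder -/

theorem norm_natCast_cpow_eq {n : ℕ} (hn : 1 ≤ n) (s : ℂ) : ‖(n : ℂ) ^ s‖ = (n : ℝ) ^ s.re := by
  rw [← Complex.ofReal_natCast, Complex.norm_cpow_eq_rpow_re_of_pos (by positivity)]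

theorem tendsto_natCast_cpow_zero {s : ℂ} (hs : s.re < 0) :
    Tendsto (fun n : ℕ => (n : ℂ) ^ s) atTop (𝓝 0) := by
  rw [tendsto_zero_iff_norm_tendsto_zero]
  have h := (tendsto_rpow_neg_atTop (neg_pos.mpr hs)).comp tendsto_natCast_atTop_atTop
  rw [neg_neg] at h
  refine h.congr' ?_
  filter_upwards [eventually_ge_atTop 1] with n hn
  rw [norm_natCast_cpow_eq hn]
  rfl

theorem differentiable_natCast_cpow {n : ℕ} (hn : 1 ≤ n) :
    Differentiable ℂ fun s : ℂ => (n : ℂ) ^ s := by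
  have : (n : ℂ) ≠ 0 := by exact_mod_cast (by omega : n ≠ 0)
  exact fun s => (hasDerivAt_id s).const_cpow (Or.inl this) |>.differentiableAt

/-- The constant bounds only the Bernoulli factor on `[0, 1]`, hence is independent of `s` and `m`;
this uniformity later gives holomorphy of the sums. -/
theorem exists_norm_emLocal_le (K : ℕ) : ∃ C : ℝ, 0 ≤ C ∧ ∀ (s : ℂ) (m : ℕ), 1 ≤ m → 0 ≤ s.re + K →
    ‖emLocal K s m‖ ≤ C * ‖fallingNeg K s‖ * (m : ℝ) ^ (-(s.re + K)) := by
  have hc : ContinuousOn (fun x : ℝ => bernoulliFun K (1 - x) / (K.factorial : ℝ))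
      (Set.Icc 0 1) := by
    have := continuous_bernoulliFun K
    fun_prop
  obtain ⟨C, hC⟩ := isCompact_Icc.exists_bound_of_continuousOn hc
  have hC0 : 0 ≤ C := (norm_nonneg _).trans (hC 0 (by simp))
  refine ⟨C, hC0, fun s m hm hs => ?_⟩
  have hm' : (1 : ℝ) ≤ m := by exact_mod_cast hm
  refine (intervalIntegral.norm_integral_le_of_norm_le_const (C := C * ‖fallingNeg K s‖ *
    (m : ℝ) ^ (-(s.re + K))) fun x hx => ?_).trans (by simp)
  rw [Set.uIoc_of_le zero_le_one] at hx
  rw [norm_mul, norm_mul, Complex.norm_real, mul_assoc,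
    Complex.norm_cpow_eq_rpow_re_of_pos (by linarith [hx.1])]
  have e : (-s - (K : ℂ)).re = -(s.re + K) := by simp; ring
  rw [e]
  have h1 := hC x ⟨hx.1.le, hx.2⟩
  have h2 : ((m : ℝ) + x) ^ (-(s.re + K)) ≤ (m : ℝ) ^ (-(s.re + K)) :=
    Real.rpow_le_rpow_of_nonpos (by linarith) (by linarith [hx.1]) (by linarith)
  have h3 : 0 ≤ (m : ℝ) + x := by linarith [hx.1]
  gcongr

/-- The remainder in the asymptotic expansion of order `K` of `∑_{m < n} m ^ (-s)`. -/
noncomputable def emTail (K : ℕ) (s : ℂ) (n : ℕ) : ℂ := ∑' i : ℕ, emLocal K s (n + i)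

/-- Two powers are spent on a summable `1 / m ^ 2`; the rest is kept as decay in the starting index
`n`. -/
theorem rpow_neg_le_mul {n m : ℕ} (hn : 1 ≤ n) (hm : n ≤ m) {p : ℝ} (hp : 2 ≤ p) :
    (m : ℝ) ^ (-p) ≤ (n : ℝ) ^ (2 - p) * ((m : ℝ) ^ 2)⁻¹ := by
  have hn' : (1 : ℝ) ≤ n := by exact_mod_cast hn
  have hm' : (n : ℝ) ≤ m := by exact_mod_cast hm
  have e : (m : ℝ) ^ (-p) = (m : ℝ) ^ (2 - p) * ((m : ℝ) ^ 2)⁻¹ := by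
    rw [← Real.rpow_natCast, ← Real.rpow_neg (by linarith), ← Real.rpow_add (by linarith)]
    congr 1
    push_cast
    ring
  rw [e]
  exact mul_le_mul_of_nonneg_right
    (Real.rpow_le_rpow_of_nonpos (by linarith) hm' (by linarith)) (by positivity)

theorem summable_inv_sq_add (n : ℕ) : Summable fun i : ℕ => (((n + i : ℕ) : ℝ) ^ 2)⁻¹ := by
  have h := (Real.summable_nat_pow_inv (p := 2)).mpr one_lt_two
  simpa only [add_comm n] using (summable_nat_add_iff n).mpr h

theorem summable_emLocal {K : ℕ} {s : ℂ} (hs : 2 ≤ s.re + K) {n : ℕ} (hn : 1 ≤ n) :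
    Summable fun i : ℕ => emLocal K s (n + i) := by
  obtain ⟨C, hC0, hC⟩ := exists_norm_emLocal_le K
  refine Summable.of_norm_bounded ((summable_inv_sq_add n).mul_left
    (C * ‖fallingNeg K s‖ * (n : ℝ) ^ (2 - (s.re + K)))) fun i => ?_
  refine (hC s (n + i) (by omega) (by linarith)).trans ?_
  rw [mul_assoc (C * ‖fallingNeg K s‖)]
  gcongr
  exact rpow_neg_le_mul hn (by omega) hs

theorem exists_norm_emTail_le (K : ℕ) : ∃ C : ℝ, 0 ≤ C ∧ ∀ (s : ℂ) (n : ℕ), 1 ≤ n → 2 ≤ s.re + K →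
    ‖emTail K s n‖ ≤ C * ‖fallingNeg K s‖ * (n : ℝ) ^ (2 - (s.re + K)) := by
  obtain ⟨C, hC0, hC⟩ := exists_norm_emLocal_le K
  set D : ℝ := ∑' i : ℕ, ((i : ℝ) ^ 2)⁻¹ with hD
  have hsum := (Real.summable_nat_pow_inv (p := 2)).mpr one_lt_two
  refine ⟨C * D, by positivity, fun s n hn hs => ?_⟩
  have hle : ∑' i : ℕ, (((n + i : ℕ) : ℝ) ^ 2)⁻¹ ≤ D :=
    (summable_inv_sq_add n).tsum_le_tsum_of_inj (fun i => n + i) (add_right_injective n)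
      (fun _ _ => by positivity) (fun _ => le_rfl) hsum
  have h := tsum_of_norm_bounded ((summable_inv_sq_add n).hasSum.mul_left
    (C * ‖fallingNeg K s‖ * (n : ℝ) ^ (2 - (s.re + K)))) (f := fun i => emLocal K s (n + i))
    fun i => by
      refine (hC s (n + i) (by omega) (by linarith)).trans ?_
      rw [mul_assoc (C * ‖fallingNeg K s‖)]
      gcongr
      exact rpow_neg_le_mul hn (by omega) hs
  refine h.trans ?_
  calc _ ≤ C * ‖fallingNeg K s‖ * (n : ℝ) ^ (2 - (s.re + K)) * D := by gcongr
    _ = _ := by ring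

theorem tendsto_emTail {K : ℕ} {s : ℂ} (hs : 2 < s.re + K) :
    Tendsto (emTail K s) atTop (𝓝 0) := by
  obtain ⟨C, hC0, hC⟩ := exists_norm_emTail_le K
  have h := (tendsto_rpow_neg_atTop (show 0 < s.re + K - 2 by linarith)).comp
    tendsto_natCast_atTop_atTop
  have h' := h.const_mul (C * ‖fallingNeg K s‖)
  rw [mul_zero] at h'
  refine squeeze_zero_norm' ?_ h'
  filter_upwards [eventually_ge_atTop 1] with n hn
  refine (hC s n hn hs.le).trans_eq ?_
  simp

theorem emTail_succ {K : ℕ} {s : ℂ} (hs : 2 ≤ s.re + K) {n : ℕ} (hn : 1 ≤ n) :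
    emTail K s n = emLocal K s n + emTail K s (n + 1) := by
  rw [emTail, (summable_emLocal hs hn).tsum_eq_zero_add, emTail]
  simp only [add_zero]
  congr 1
  exact tsum_congr fun i => by rw [add_assoc, add_comm 1 i]

/-- This applies at `s = -a` with `a < K`, where the `K`-th derivative of the polynomial `x ^ a`
vanishes. -/
theorem emTail_eq_zero {K : ℕ} {s : ℂ} (h : fallingNeg K s = 0) (n : ℕ) : emTail K s n = 0 := by
  simp [emTail, emLocal, h]

/-- The half plane `re s > 2 - K` without the point `1`. -/
def emDomain (K : ℕ) : Set ℂ := {s | 2 < s.re + K ∧ s ≠ 1}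

theorem isOpen_emDomain (K : ℕ) : IsOpen (emDomain K) :=
  (isOpen_lt (f := fun _ : ℂ => (2 : ℝ)) (g := fun s : ℂ => s.re + K) (by fun_prop)
    (by fun_prop)).inter (isOpen_ne (x := (1 : ℂ)))

theorem differentiableOn_emCoeff (j : ℕ) : DifferentiableOn ℂ (fun s => emCoeff s j) {1}ᶜ := by
  cases j with
  | zero =>
    intro s hs
    have : 1 - s ≠ 0 := sub_ne_zero.mpr (Ne.symm hs)
    simp only [emCoeff]
    refine DifferentiableAt.differentiableWithinAt ?_
    fun_prop (disch := assumption)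
  | succ k =>
    simp only [emCoeff]
    exact ((differentiable_fallingNeg k).const_mul _).differentiableOn

/-- Solving the Euler-Maclaurin formula for the remainder expresses it by elementary functions,
which avoids differentiating under the integral. -/
theorem differentiableOn_emLocal {K : ℕ} (hK : 1 ≤ K) {m : ℕ} (hm : 1 ≤ m) :
    DifferentiableOn ℂ (fun s => emLocal K s m) {1}ᶜ := by
  have h : DifferentiableOn ℂ (fun s => ∑ j ∈ Finset.range (K + 1),
      emCoeff s j * (((m + 1 : ℕ) : ℂ) ^ (1 - s - j) - (m : ℂ) ^ (1 - s - j)) - (m : ℂ) ^ (-s))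
      {1}ᶜ := by
    refine DifferentiableOn.sub (DifferentiableOn.fun_sum fun j _ =>
      (differentiableOn_emCoeff j).mul ?_) ?_
    · have h1 := (differentiable_natCast_cpow (n := m + 1) (by omega)).comp
        (show Differentiable ℂ fun s : ℂ => 1 - s - j by fun_prop)
      have h2 := (differentiable_natCast_cpow hm).comp
        (show Differentiable ℂ fun s : ℂ => 1 - s - j by fun_prop)
      exact (h1.sub h2).differentiableOn
    · exact ((differentiable_natCast_cpow hm).comp differentiable_neg).differentiableOn
  refine h.congr fun s hs => ?_
  rw [natCast_cpow_neg_eq hK hs hm]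
  ring

theorem differentiableOn_emTail {K : ℕ} (hK : 1 ≤ K) {n : ℕ} (hn : 1 ≤ n) :
    DifferentiableOn ℂ (fun s => emTail K s n) (emDomain K) := by
  intro s hs
  obtain ⟨C, hC0, hC⟩ := exists_norm_emLocal_le K
  set M : ℝ := ‖s‖ + 1
  -- Bounding `‖w‖` bounds `fallingNeg K` uniformly, so the Weierstrass test applies near `s`.
  have hU : IsOpen (emDomain K ∩ {w | ‖w‖ < M}) :=
    (isOpen_emDomain K).inter (isOpen_lt continuous_norm continuous_const)
  have hd := Complex.differentiableOn_tsum_of_summable_norm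
    (F := fun i w => emLocal K w (n + i))
    ((summable_inv_sq_add n).mul_left (C * (M + K) ^ K))
    (fun i => (differentiableOn_emLocal hK (m := n + i) (by omega)).mono fun w hw => hw.1.2) hU ?_
  · exact ((hd s ⟨hs, by simp [M]⟩).differentiableAt
      (hU.mem_nhds ⟨hs, by simp [M]⟩)).differentiableWithinAt
  · rintro i w ⟨⟨hw, -⟩, hwM⟩
    refine (hC w (n + i) (by omega) (by linarith)).trans ?_
    have h1 := norm_fallingNeg_le K (le_of_lt hwM)
    have h2 : ((n + i : ℕ) : ℝ) ^ (-(w.re + K)) ≤ (((n + i : ℕ) : ℝ) ^ 2)⁻¹ := by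
      refine (rpow_neg_le_mul hn (Nat.le_add_right n i) hw.le).trans ?_
      refine mul_le_of_le_one_left (by positivity) ?_
      exact Real.rpow_le_one_of_one_le_of_nonpos (by exact_mod_cast hn) (by linarith)
    have h3 : 0 ≤ (M + K) ^ K := by positivity
    gcongr

theorem zetaSymbol_natCast (s : ℂ) {n : ℕ} (hn : 1 ≤ n) : zetaSymbol s n = (n : ℂ) ^ (-s) := by
  rw [zetaSymbol, if_pos (by exact_mod_cast hn), Complex.ofReal_natCast]

theorem zetaSymbol_zero (s : ℂ) : zetaSymbol s ((0 : ℕ) : ℝ) = 0 := by simp [zetaSymbol]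

theorem strictNestedSum_singleton_succ (s : ℂ) (n : ℕ) :
    strictNestedSum [s] (n + 1) = strictNestedSum [s] n + zetaSymbol s n := by
  simp [strictNestedSum, Finset.sum_range_succ]

/-- The constant term in the asymptotic expansion of `∑_{m < n} m ^ (-s)`. -/
noncomputable def emConst (K : ℕ) (s : ℂ) : ℂ :=
  -∑ j ∈ Finset.range (K + 1), emCoeff s j - emTail K s 1

/-- The local formulas telescope, and `emConst` is normalized so that the identity holds at `n = 1`,
where the sum is zero. -/
theorem strictNestedSum_singleton_eq_emConst {K : ℕ} (hK : 1 ≤ K) {s : ℂ} (hs : s ∈ emDomain K)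
    {n : ℕ} (hn : 1 ≤ n) :
    strictNestedSum [s] n = emConst K s +
      ∑ j ∈ Finset.range (K + 1), emCoeff s j * (n : ℂ) ^ (1 - s - j) + emTail K s n := by
  induction n, hn using Nat.le_induction with
  | base =>
    simp [strictNestedSum, emConst, zetaSymbol]
    ring
  | succ n hn ih =>
    rw [strictNestedSum_singleton_succ, ih, zetaSymbol_natCast s hn,
      natCast_cpow_neg_eq hK hs.2 hn, emTail_succ hs.1.le hn]
    simp only [mul_sub, Finset.sum_sub_distrib]
    ring

/-! ### The constant term is zeta, by analytic continuation -/

theorem tendsto_strictNestedSum_singleton {s : ℂ} (hs : 1 < s.re) :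
    Tendsto (strictNestedSum [s]) atTop (𝓝 (riemannZeta s)) := by
  have h := ((Complex.summable_one_div_nat_cpow.mpr hs).hasSum).tendsto_sum_nat
  rw [← zeta_eq_tsum_one_div_nat_cpow hs] at h
  refine h.congr fun n => ?_
  refine Finset.sum_congr rfl fun m _ => ?_
  rcases Nat.eq_zero_or_pos m with rfl | hm
  · rw [zetaSymbol_zero, zero_mul, Nat.cast_zero,
      Complex.zero_cpow (Complex.ne_zero_of_one_lt_re hs), div_zero]
  · rw [zetaSymbol_natCast s hm, strictNestedSum, mul_one, Complex.cpow_neg, one_div]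

theorem emConst_eq_of_one_lt_re {K : ℕ} (hK : 1 ≤ K) {s : ℂ} (hs : 1 < s.re) :
    emConst K s = riemannZeta s := by
  have hK' : (1 : ℝ) ≤ K := by exact_mod_cast hK
  have hd : s ∈ emDomain K := ⟨by linarith, by rintro rfl; simp at hs⟩
  have h1 : Tendsto (fun n : ℕ => emConst K s + ∑ j ∈ Finset.range (K + 1),
      emCoeff s j * (n : ℂ) ^ (1 - s - j) + emTail K s n) atTop (𝓝 (emConst K s + 0 + 0)) := by
    refine (tendsto_const_nhds.add ?_).add (tendsto_emTail hd.1)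
    rw [← Finset.sum_const_zero (s := Finset.range (K + 1))]
    refine tendsto_finsetSum _ fun j _ => ?_
    rw [← mul_zero (emCoeff s j)]
    refine (tendsto_natCast_cpow_zero ?_).const_mul _
    simp only [Complex.sub_re, Complex.one_re, Complex.natCast_re]
    have : (0 : ℝ) ≤ j := j.cast_nonneg
    linarith
  rw [add_zero, add_zero] at h1
  refine tendsto_nhds_unique (h1.congr' ?_) (tendsto_strictNestedSum_singleton hs)
  filter_upwards [eventually_ge_atTop 1] with n hn
  rw [strictNestedSum_singleton_eq_emConst hK hd hn]

theorem isPreconnected_emDomain {K : ℕ} (hK : 2 ≤ K) : IsPreconnected (emDomain K) := by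
  have hK' : (2 : ℝ) ≤ K := by exact_mod_cast hK
  have hre : IsLinearMap ℝ Complex.re := Complex.reLm.isLinear
  have him : IsLinearMap ℝ Complex.im := Complex.imLm.isLinear
  have c0 := convex_halfSpace_gt hre (2 - (K : ℝ))
  have hA := (c0.inter (convex_halfSpace_gt him 0)).isPreconnected
  have hB := (c0.inter (convex_halfSpace_lt him 0)).isPreconnected
  have hC := (c0.inter (convex_halfSpace_lt hre 1)).isPreconnected
  have hD := (convex_halfSpace_gt hre 1).isPreconnected
  -- The punctured half plane is a chain of convex pieces (upper, left, lower, right), each meeting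
  -- the union of its predecessors at the displayed point.
  have h := (((hA.union (⟨1 / 2, 1⟩ : ℂ) ?_ ?_ hC).union (⟨1 / 2, -1⟩ : ℂ) ?_ ?_ hB).union
    (⟨2, 1⟩ : ℂ) ?_ ?_ hD)
  · convert h using 1
    ext s
    simp only [emDomain, Set.mem_ofPred_eq, Set.mem_union, Set.mem_inter_iff]
    constructor
    · rintro ⟨h1, h2⟩
      have h1' : 2 - (K : ℝ) < s.re := by linarith
      rcases lt_trichotomy s.im 0 with h | h | h
      · exact Or.inl (Or.inr ⟨h1', h⟩)
      · rcases lt_trichotomy s.re 1 with h' | h' | h'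
        · exact Or.inl (Or.inl (Or.inr ⟨h1', h'⟩))
        · exact absurd (Complex.ext h' h) h2
        · exact Or.inr h'
      · exact Or.inl (Or.inl (Or.inl ⟨h1', h⟩))
    · rintro (((⟨h1, h2⟩ | ⟨h1, h2⟩) | ⟨h1, h2⟩) | h1)
      · exact ⟨by linarith, by rintro rfl; simp at h2⟩
      · exact ⟨by linarith, by rintro rfl; simp at h2⟩
      · exact ⟨by linarith, by rintro rfl; simp at h2⟩
      · exact ⟨by linarith, by rintro rfl; simp at h1⟩
  all_goals simp only [Set.mem_ofPred_eq, Set.mem_union, Set.mem_inter_iff]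
  · exact ⟨by linarith, by norm_num⟩
  · exact ⟨by linarith, by norm_num⟩
  · exact Or.inr ⟨by linarith, by norm_num⟩
  · exact ⟨by linarith, by norm_num⟩
  · exact Or.inl (Or.inl ⟨by linarith, by norm_num⟩)
  · norm_num

/-- Both sides are holomorphic on the connected set `emDomain K` and agree near `2`, where the
series converges. -/
theorem emConst_eq_riemannZeta {K : ℕ} (hK : 2 ≤ K) {s : ℂ} (hs : s ∈ emDomain K) :
    emConst K s = riemannZeta s := by
  have hsub : emDomain K ⊆ {1}ᶜ := fun w hw => hw.2
  have h1 : DifferentiableOn ℂ (emConst K) (emDomain K) :=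
    ((DifferentiableOn.fun_sum fun j _ => (differentiableOn_emCoeff j).mono hsub).fun_neg).fun_sub
      (differentiableOn_emTail (by omega) le_rfl)
  have h2 := differentiableOn_riemannZeta.mono hsub
  have hK' : (2 : ℝ) ≤ K := by exact_mod_cast hK
  refine (h1.analyticOnNhd (isOpen_emDomain K)).eqOn_of_preconnected_of_eventuallyEq
    (h2.analyticOnNhd (isOpen_emDomain K)) (isPreconnected_emDomain hK)
    (z₀ := 2) ⟨by norm_num; linarith, by norm_num⟩ ?_ hs
  filter_upwards [(isOpen_lt continuous_const Complex.continuous_re).mem_nhds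
    (show (1 : ℝ) < (2 : ℂ).re by norm_num)] with w hw
  exact emConst_eq_of_one_lt_re (by omega) hw

/-- The asymptotic expansion of `∑_{m < n} m ^ (-s)`. -/
theorem strictNestedSum_singleton_eq {K : ℕ} (hK : 2 ≤ K) {s : ℂ} (hs : s ∈ emDomain K)
    {n : ℕ} (hn : 1 ≤ n) :
    strictNestedSum [s] n = riemannZeta s +
      ∑ j ∈ Finset.range (K + 1), emCoeff s j * (n : ℂ) ^ (1 - s - j) + emTail K s n := by
  rw [strictNestedSum_singleton_eq_emConst (by omega) hs hn, emConst_eq_riemannZeta hK hs]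

/-! ### Finite parts of nested sums of depth one and two -/

theorem chenPartialSum_singleton (s : ℂ) (N : ℕ) :
    chenPartialSum [s] N = ∑ n ∈ Finset.range (N + 1), zetaSymbol s n := by
  simp [chenPartialSum, strictNestedSum]

theorem hasFinitePart_singleton {s : ℂ} (hs : ∀ k : ℕ, s + k ≠ 1) :
    HasFinitePart (chenPartialSum [s]) (riemannZeta s) := by
  obtain ⟨K, hK⟩ := exists_nat_gt (max 2 (2 - s.re))
  have hK2 : (2 : ℝ) < K := (le_max_left _ _).trans_lt hK
  have hK3 : 2 - s.re < K := (le_max_right _ _).trans_lt hK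
  have hd : s ∈ emDomain K := ⟨by linarith, by simpa using hs 0⟩
  have h1 : HasFinitePart (fun N : ℕ => ∑ j ∈ Finset.range (K + 1),
      emCoeff s j * (N : ℂ) ^ (1 - s - j)) (∑ j ∈ Finset.range (K + 1), emCoeff s j * 0) :=
    HasFinitePart.sum _ fun j _ => (hasFinitePart_cpow fun h => hs j (by
      linear_combination -h)).const_mul _
  -- The cut-off is `n ≤ N`, so the term `N ^ (-s)` is added to the strict sum. The case `k = 1` of
  -- the hypothesis says that its exponent is nonzero.
  have h2 := (((HasFinitePart.of_tendsto (tendsto_const_nhds (x := riemannZeta s))).add h1).add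
    (HasFinitePart.of_tendsto (tendsto_emTail hd.1))).add
      (hasFinitePart_cpow (α := -s) fun h => hs 1 (by rw [neg_eq_zero.mp h]; simp))
  simp only [mul_zero, Finset.sum_const_zero, add_zero] at h2
  refine h2.congr' ?_
  filter_upwards [eventually_ge_atTop 1] with N hN
  rw [chenPartialSum, strictNestedSum_singleton_succ, zetaSymbol_natCast s hN,
    strictNestedSum_singleton_eq (by exact_mod_cast hK2.le) hd hN]

/-- The contribution of the remainder `emTail K s₂` to the finite part of the nested sum. -/
noncomputable def emPairTail (K : ℕ) (s₁ s₂ : ℂ) : ℂ :=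
  ∑' n : ℕ, zetaSymbol s₁ n * emTail K s₂ n

theorem exists_norm_emPairTail_term_le (K : ℕ) : ∃ C : ℝ, 0 ≤ C ∧ ∀ (s₁ s₂ : ℂ) (n : ℕ),
    2 ≤ s₂.re + K → 4 ≤ s₁.re + s₂.re + K →
    ‖zetaSymbol s₁ n * emTail K s₂ n‖ ≤ C * ‖fallingNeg K s₂‖ * ((n : ℝ) ^ 2)⁻¹ := by
  obtain ⟨C, hC0, hC⟩ := exists_norm_emTail_le K
  refine ⟨C, hC0, fun s₁ s₂ n h2 h4 => ?_⟩
  rcases Nat.eq_zero_or_pos n with rfl | hn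
  · rw [zetaSymbol_zero]
    simp
  have hn' : (1 : ℝ) ≤ n := by exact_mod_cast hn
  have e : (n : ℝ) ^ (-s₁.re) * (n : ℝ) ^ (2 - (s₂.re + K)) ≤ ((n : ℝ) ^ 2)⁻¹ := by
    rw [← Real.rpow_add (by linarith), ← Real.rpow_natCast, ← Real.rpow_neg (by linarith)]
    refine Real.rpow_le_rpow_of_exponent_le hn' ?_
    push_cast
    linarith
  rw [norm_mul, zetaSymbol_natCast s₁ hn, norm_natCast_cpow_eq hn, Complex.neg_re]
  calc _ ≤ (n : ℝ) ^ (-s₁.re) * (C * ‖fallingNeg K s₂‖ * (n : ℝ) ^ (2 - (s₂.re + K))) := by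
        gcongr
        exact hC s₂ n hn h2
    _ = C * ‖fallingNeg K s₂‖ * ((n : ℝ) ^ (-s₁.re) * (n : ℝ) ^ (2 - (s₂.re + K))) := by ring
    _ ≤ _ := by gcongr

theorem summable_emPairTail {K : ℕ} {s₁ s₂ : ℂ} (h2 : 2 ≤ s₂.re + K)
    (h4 : 4 ≤ s₁.re + s₂.re + K) : Summable fun n : ℕ => zetaSymbol s₁ n * emTail K s₂ n := by
  obtain ⟨C, hC0, hC⟩ := exists_norm_emPairTail_term_le K
  exact Summable.of_norm_bounded
    (((Real.summable_nat_pow_inv (p := 2)).mpr one_lt_two).mul_left _) fun n => hC s₁ s₂ n h2 h4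

theorem emPairTail_eq_zero {K : ℕ} {s₂ : ℂ} (h : fallingNeg K s₂ = 0) (s₁ : ℂ) :
    emPairTail K s₁ s₂ = 0 := by
  simp [emPairTail, emTail_eq_zero h]

/-- Stated along a curve, since iterated and diagonal evaluation need only analyticity in one
variable. -/
theorem differentiableOn_emPairTail {K : ℕ} (hK : 1 ≤ K) {U : Set ℂ} (hU : IsOpen U)
    {γ₁ γ₂ : ℂ → ℂ} (h₁ : DifferentiableOn ℂ γ₁ U) (h₂ : DifferentiableOn ℂ γ₂ U)
    (hdom : ∀ z ∈ U, γ₂ z ∈ emDomain K) (h4 : ∀ z ∈ U, 4 ≤ (γ₁ z).re + (γ₂ z).re + K)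
    {M : ℝ} (hM : ∀ z ∈ U, ‖γ₂ z‖ ≤ M) :
    DifferentiableOn ℂ (fun z => emPairTail K (γ₁ z) (γ₂ z)) U := by
  obtain ⟨C, hC0, hC⟩ := exists_norm_emPairTail_term_le K
  refine Complex.differentiableOn_tsum_of_summable_norm
    (((Real.summable_nat_pow_inv (p := 2)).mpr one_lt_two).mul_left (C * (M + K) ^ K))
    (fun n => ?_) hU fun n z hz => ?_
  · rcases Nat.eq_zero_or_pos n with rfl | hn
    · simp only [zetaSymbol_zero, zero_mul]
      exact differentiableOn_const _
    · simp only [zetaSymbol_natCast _ hn]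
      exact ((differentiable_natCast_cpow hn).comp_differentiableOn h₁.fun_neg).mul
        ((differentiableOn_emTail hK hn).comp h₂ hdom)
  · refine (hC _ _ n (hdom z hz).1.le (h4 z hz)).trans ?_
    have := norm_fallingNeg_le K (hM z hz)
    gcongr

/-- The finite part of the nested sum of `n₁ ^ (-s₁) * n₂ ^ (-s₂)`. -/
noncomputable def pairFinitePart (K : ℕ) (s₁ s₂ : ℂ) : ℂ :=
  riemannZeta s₂ * riemannZeta s₁ +
    ∑ j ∈ Finset.range (K + 1), emCoeff s₂ j * riemannZeta (s₁ + s₂ - 1 + j) + emPairTail K s₁ s₂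

/-- Each power of `n` in the expansion of the inner sum turns the outer sum into a depth-one sum
with exponent `s₁ + s₂ - 1 + j`, while `h4` makes the remainder series converge. The nonvanishing
hypotheses exclude constant terms hidden in powers of `N`. -/
theorem hasFinitePart_pair {K : ℕ} (hK : 2 ≤ K) {s₁ s₂ : ℂ} (hd : s₂ ∈ emDomain K)
    (h1 : ∀ k : ℕ, s₁ + k ≠ 1) (h12 : ∀ k : ℕ, s₁ + s₂ + k ≠ 2) (h4 : 4 ≤ s₁.re + s₂.re + K) :
    HasFinitePart (chenPartialSum [s₁, s₂]) (pairFinitePart K s₁ s₂) := by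
  have ht := (tendsto_add_atTop_iff_nat (f := fun N => ∑ n ∈ Finset.range N,
    zetaSymbol s₁ n * emTail K s₂ n) 1).mpr (summable_emPairTail hd.1.le h4).hasSum.tendsto_sum_nat
  have h := (((hasFinitePart_singleton h1).const_mul (riemannZeta s₂)).add
    (HasFinitePart.sum (Finset.range (K + 1)) fun j _ =>
      (hasFinitePart_singleton (s := s₁ + s₂ - 1 + j) fun k hk => h12 (j + k) (by
        push_cast; linear_combination hk)).const_mul (emCoeff s₂ j))).add
    (HasFinitePart.of_tendsto ht)
  refine h.congr' (Eventually.of_forall fun N => ?_)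
  simp only [chenPartialSum_singleton, Finset.mul_sum]
  rw [Finset.sum_comm, ← Finset.sum_add_distrib, ← Finset.sum_add_distrib, chenPartialSum]
  change _ = ∑ n ∈ Finset.range (N + 1), zetaSymbol s₁ n * strictNestedSum [s₂] n
  refine Finset.sum_congr rfl fun n _ => ?_
  -- The expansion of the inner sum starts at `n = 1`; at `n = 0` the symbol vanishes.
  rcases Nat.eq_zero_or_pos n with rfl | hn
  · simp only [zetaSymbol_zero, mul_zero, zero_mul, Finset.sum_const_zero, add_zero]
  · have hn0 : (n : ℂ) ≠ 0 := by exact_mod_cast hn.ne'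
    have e : ∀ j : ℕ, (n : ℂ) ^ (-(s₁ + s₂ - 1 + j)) = (n : ℂ) ^ (-s₁) * (n : ℂ) ^ (1 - s₂ - j) := by
      intro j
      rw [← Complex.cpow_add _ _ hn0]
      congr 1
      ring
    simp only [strictNestedSum_singleton_eq hK hd hn, zetaSymbol_natCast _ hn, e, mul_add,
      Finset.mul_sum]
    congr 1
    congr 1
    · ring
    · exact Finset.sum_congr rfl fun j _ => by ring

/-! ### The twisted regularization in degree at most two -/

theorem sum_composition_zero {M : Type*} [AddCommMonoid M] (f : Composition 0 → M) :
    ∑ I, f I = f (Composition.ones 0) := by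
  refine Fintype.sum_eq_single _ fun I hI => absurd (Composition.eq_ones_iff_length.mpr ?_) hI
  exact Nat.le_zero.mp I.length_le

theorem sum_composition_one {M : Type*} [AddCommMonoid M] (f : Composition 1 → M) :
    ∑ I, f I = f (Composition.single 1 one_pos) := by
  have : Finset.univ = {Composition.single 1 one_pos} := by
    ext I
    simp only [Finset.mem_univ, Finset.mem_singleton, true_iff]
    rw [Composition.eq_single_iff_length]
    exact le_antisymm I.length_le (I.length_pos_of_pos one_pos)
  rw [this, Finset.sum_singleton]

theorem sum_composition_two {M : Type*} [AddCommMonoid M] (f : Composition 2 → M) :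
    ∑ I, f I = f (Composition.ones 2) + f (Composition.single 2 two_pos) := by
  classical
  have : Finset.univ = {Composition.ones 2, Composition.single 2 two_pos} := by
    ext I
    simp only [Finset.mem_univ, Finset.mem_insert, Finset.mem_singleton, true_iff]
    rw [Composition.eq_single_iff_length, Composition.eq_ones_iff_length]
    have h1 := I.length_le
    have h2 := I.length_pos_of_pos two_pos
    omega
  rw [this, Finset.sum_pair]
  intro h
  have := congrArg Composition.length h
  simp at this

theorem hoffmanExp_nil : hoffmanExp (symbolWord []) = symbolWord [] := by
  rw [hoffmanExp, linearCombination_symbolWord]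
  refine (sum_composition_zero _).trans ?_
  simp [contractWord, List.splitWrtComposition, List.splitWrtCompositionAux]

theorem hoffmanLog_nil : hoffmanLog (symbolWord []) = symbolWord [] := by
  rw [hoffmanLog, linearCombination_symbolWord]
  refine (sum_composition_zero _).trans ?_
  simp [contractWord, List.splitWrtComposition, List.splitWrtCompositionAux]

theorem hoffmanExp_singleton (s : ℂ) : hoffmanExp (symbolWord [s]) = symbolWord [s] := by
  rw [hoffmanExp, linearCombination_symbolWord]
  refine (sum_composition_one _).trans ?_
  simp [contractWord, List.splitWrtComposition, List.splitWrtCompositionAux]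

theorem hoffmanLog_singleton (s : ℂ) : hoffmanLog (symbolWord [s]) = symbolWord [s] := by
  rw [hoffmanLog, linearCombination_symbolWord]
  refine (sum_composition_one _).trans ?_
  simp [contractWord, List.splitWrtComposition, List.splitWrtCompositionAux]

theorem hoffmanExp_pair (s t : ℂ) :
    hoffmanExp (symbolWord [s, t]) = symbolWord [s, t] + (1 / 2 : ℂ) • symbolWord [s + t] := by
  rw [hoffmanExp, linearCombination_symbolWord]
  refine (sum_composition_two _).trans ?_
  simp [contractWord, List.splitWrtComposition, List.splitWrtCompositionAux, Composition.ones,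
    List.replicate]

theorem hoffmanLog_pair (s t : ℂ) :
    hoffmanLog (symbolWord [s, t]) = symbolWord [s, t] - (1 / 2 : ℂ) • symbolWord [s + t] := by
  rw [hoffmanLog, linearCombination_symbolWord]
  refine (sum_composition_two _).trans ?_
  simp [contractWord, List.splitWrtComposition, List.splitWrtCompositionAux, Composition.ones,
    List.replicate, Composition.length, sub_eq_add_neg, neg_div]

theorem twistedReg_nil : twistedReg [] (symbolWord []) = symbolWord [] := by
  simp [twistedReg, hoffmanLog_nil, tensorReg, hoffmanExp_nil]

theorem twistedReg_singleton (s z : ℂ) :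
    twistedReg [z] (symbolWord [s]) = symbolWord [s + z] := by
  simp [twistedReg, hoffmanLog_singleton, tensorReg, hoffmanExp_singleton]

/-- The two contracted words differ: the one from `hoffmanLog` already has degree one and receives
only the first variable, whereas the one from `hoffmanExp` contracts a pair already regularized in
both. -/
theorem twistedReg_pair (s t z w : ℂ) :
    twistedReg [z, w] (symbolWord [s, t]) = symbolWord [s + z, t + w] +
      (1 / 2 : ℂ) • symbolWord [s + t + (z + w)] - (1 / 2 : ℂ) • symbolWord [s + t + z] := by
  simp only [twistedReg, LinearMap.comp_apply, hoffmanLog_pair, map_sub, map_smul, tensorReg,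
    linearCombination_symbolWord, List.zipWith_cons_cons, List.zipWith_nil_left,
    List.zipWith_nil_right, hoffmanExp_pair, hoffmanExp_singleton]
  rw [show s + z + (t + w) = s + t + (z + w) by ring]

theorem mem_of_mem_support_symbolWord {v w : List ℂ} (h : v ∈ (symbolWord w).support) : v = w := by
  simpa [symbolWord, Finsupp.single_apply, eq_comm] using h

theorem cutoffChenSumDefined_symbolWord {w : List ℂ} {c : ℂ}
    (h : HasFinitePart (chenPartialSum w) c) : CutoffChenSumDefined (symbolWord w) := by
  intro v hv
  rw [mem_of_mem_support_symbolWord hv]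
  exact ⟨c, h⟩

theorem CutoffChenSumDefined.add {x y : SymbolTensor} (hx : CutoffChenSumDefined x)
    (hy : CutoffChenSumDefined y) : CutoffChenSumDefined (x + y) := by
  classical
  intro w hw
  rcases Finset.mem_union.mp (Finsupp.support_add hw) with h | h
  exacts [hx w h, hy w h]

theorem CutoffChenSumDefined.smul {x : SymbolTensor} (a : ℂ) (hx : CutoffChenSumDefined x) :
    CutoffChenSumDefined (a • x) :=
  fun w hw => hx w (Finsupp.support_smul hw)

theorem cutoffChenSum_symbolWord {w : List ℂ} {c : ℂ} (h : HasFinitePart (chenPartialSum w) c) :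
    cutoffChenSum (symbolWord w) = c := by
  rw [cutoffChenSum, linearCombination_symbolWord, h.finitePart_eq]

theorem diagNestedSum_nil (z : ℂ) : diagNestedSum [] z = 1 := by
  have h : HasFinitePart (chenPartialSum []) 1 := HasFinitePart.of_tendsto tendsto_const_nhds
  rw [diagNestedSum, regNestedSum, List.length_nil, List.replicate_zero, twistedReg_nil,
    cutoffChenSum_symbolWord h]

theorem diagNestedSumLaurent_nil : diagNestedSumLaurent (symbolWord []) = 1 := by
  rw [diagNestedSumLaurent, linearCombination_symbolWord, ← laurentGerm_one]
  congr 1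
  exact funext diagNestedSum_nil

/-! ### Regularized nested sums at nonpositive integers -/

theorem fallingNeg_neg_natCast (k a : ℕ) : fallingNeg k (-(a : ℂ)) = (a.descFactorial k : ℂ) := by
  induction k with
  | zero => simp [fallingNeg_zero]
  | succ k ih =>
    rw [fallingNeg_succ, ih, Nat.descFactorial_succ]
    rcases le_or_gt k a with h | h
    · push_cast [h]
      ring
    · simp [Nat.descFactorial_of_lt h]

theorem emCoeff_neg_natCast (a j : ℕ) :
    emCoeff (-(a : ℂ)) j = (bernoulli j : ℂ) * ((a + 1).choose j : ℂ) / ((a : ℂ) + 1) := by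
  have ha : (a : ℂ) + 1 ≠ 0 := Nat.cast_add_one_ne_zero a
  cases j with
  | zero => simp [emCoeff, add_comm]
  | succ k =>
    have h := Nat.add_one_mul_choose_eq a k
    have h' : ((a : ℂ) + 1) * (a.choose k : ℂ) = ((a + 1).choose (k + 1) : ℂ) * ((k : ℂ) + 1) := by
      exact_mod_cast h
    have hk : (k.factorial : ℂ) ≠ 0 := by exact_mod_cast k.factorial_ne_zero
    have hk1 : (k : ℂ) + 1 ≠ 0 := Nat.cast_add_one_ne_zero k
    rw [emCoeff, fallingNeg_neg_natCast, Nat.descFactorial_eq_factorial_mul_choose,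
      Nat.factorial_succ]
    push_cast
    field_simp
    linear_combination (bernoulli (k + 1) : ℂ) * h'

/-- `emCoeff (-a₂ + z) (a₁ + a₂ + 2)` divided by its zero `z`. -/
noncomputable def polarCoeff (a₁ a₂ : ℕ) (z : ℂ) : ℂ :=
  -((bernoulli (a₁ + a₂ + 2) : ℂ) / ((a₁ + a₂ + 2).factorial : ℂ)) *
    (fallingNeg a₂ (-(a₂ : ℂ) + z) * fallingNeg a₁ (z + 1))

/-- In the product for `fallingNeg` the factor of index `a₂` equals `-z`; the factors before and
after it form the two products in `polarCoeff`. -/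
theorem emCoeff_eq_mul_polarCoeff (a₁ a₂ : ℕ) (z : ℂ) :
    emCoeff (-(a₂ : ℂ) + z) (a₁ + a₂ + 2) = z * polarCoeff a₁ a₂ z := by
  have h : fallingNeg (a₁ + a₂ + 1) (-(a₂ : ℂ) + z) =
      fallingNeg a₂ (-(a₂ : ℂ) + z) * (-z) * fallingNeg a₁ (z + 1) := by
    rw [show a₁ + a₂ + 1 = (a₂ + 1) + a₁ by ring, fallingNeg, Finset.prod_range_add,
      Finset.prod_range_succ]
    congr 1
    · rw [fallingNeg]
      congr 1
      ring
    · refine Finset.prod_congr rfl fun i _ => ?_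
      push_cast
      ring
  rw [emCoeff, h, polarCoeff]
  ring

theorem polarCoeff_zero (a₁ a₂ : ℕ) : polarCoeff a₁ a₂ 0 = (-1) ^ (a₁ + 1) * (a₁.factorial : ℂ) *
    (a₂.factorial : ℂ) * ((bernoulli (a₁ + a₂ + 2) : ℂ) / ((a₁ + a₂ + 2).factorial : ℂ)) := by
  have h : fallingNeg a₁ (0 + 1) = (-1) ^ a₁ * (a₁.factorial : ℂ) := by
    induction a₁ with
    | zero => simp [fallingNeg_zero]
    | succ k ih =>
      rw [fallingNeg_succ, ih, Nat.factorial_succ]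
      push_cast
      ring
  rw [polarCoeff, h, add_zero, fallingNeg_neg_natCast, Nat.descFactorial_self, pow_succ]
  ring

theorem differentiable_polarCoeff (a₁ a₂ : ℕ) : Differentiable ℂ (polarCoeff a₁ a₂) := by
  unfold polarCoeff
  have h1 := (differentiable_fallingNeg a₂).comp
    (show Differentiable ℂ fun z : ℂ => -(a₂ : ℂ) + z by fun_prop)
  have h2 := (differentiable_fallingNeg a₁).comp
    (show Differentiable ℂ fun z : ℂ => z + 1 by fun_prop)
  exact (h1.mul h2).const_mul _

/-- The part of the regularized nested sum at `(-a₁, -a₂)` that is analytic at `(0, 0)`. -/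
noncomputable def regularPart (a₁ a₂ : ℕ) (z₁ z₂ : ℂ) : ℂ :=
  riemannZeta (-(a₂ : ℂ) + z₂) * riemannZeta (-(a₁ : ℂ) + z₁) +
    ∑ j ∈ (Finset.range (a₁ + a₂ + 6 + 1)).erase (a₁ + a₂ + 2),
      emCoeff (-(a₂ : ℂ) + z₂) j * riemannZeta (-(a₁ : ℂ) + z₁ + (-(a₂ : ℂ) + z₂) - 1 + j) +
    emPairTail (a₁ + a₂ + 6) (-(a₁ : ℂ) + z₁) (-(a₂ : ℂ) + z₂) +
    (1 / 2 * riemannZeta (-(a₁ : ℂ) + -(a₂ : ℂ) + (z₁ + z₂)) -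
      1 / 2 * riemannZeta (-(a₁ : ℂ) + -(a₂ : ℂ) + z₁))

/-- Every coincidence of a shifted argument with a pole or a zero exponent makes a small
perturbation an integer, hence zero. -/
theorem eq_zero_of_eq_intCast {z : ℂ} (hz : ‖z‖ < 1) {n : ℤ} (h : z = n) : z = 0 := by
  rw [h, Complex.norm_intCast] at hz
  have : |n| < 1 := by exact_mod_cast hz
  rw [h, Int.abs_lt_one_iff.mp this, Int.cast_zero]

theorem add_natCast_ne_one {a : ℕ} {z : ℂ} (hz : ‖z‖ < 1) (hz0 : z ≠ 0) (k : ℕ) :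
    -(a : ℂ) + z + k ≠ 1 := fun h =>
  hz0 (eq_zero_of_eq_intCast hz (n := 1 + a - k) (by push_cast; linear_combination h))

theorem neg_natCast_add_ne_one (a : ℕ) {z : ℂ} (hz : ‖z‖ < 1) : -(a : ℂ) + z ≠ 1 := by
  intro h
  have h0 := eq_zero_of_eq_intCast hz (n := 1 + a) (by push_cast; linear_combination h)
  have : z = ((a + 1 : ℕ) : ℂ) := by push_cast; linear_combination h
  rw [h0] at this
  exact Nat.succ_ne_zero a (by exact_mod_cast this.symm)

theorem abs_re_lt_of_norm_lt {z : ℂ} {r : ℝ} (hz : ‖z‖ < r) : -r < z.re ∧ z.re < r :=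
  abs_lt.mp ((Complex.abs_re_le_norm z).trans_lt hz)

theorem neg_natCast_add_mem_emDomain (a₁ a₂ : ℕ) {z : ℂ} (hz : ‖z‖ < 1 / 4) :
    -(a₂ : ℂ) + z ∈ emDomain (a₁ + a₂ + 6) := by
  refine ⟨?_, neg_natCast_add_ne_one a₂ (by linarith)⟩
  have := abs_re_lt_of_norm_lt hz
  have h1 : (0 : ℝ) ≤ a₁ := a₁.cast_nonneg
  simp only [Complex.add_re, Complex.neg_re, Complex.natCast_re]
  push_cast
  linarith

/-- The two perturbations cost at most `1/2`, so the order `a₁ + a₂ + 6` leaves room; it also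
exceeds the polar index `a₁ + a₂ + 2`. -/
theorem four_le_re_add_re (a₁ a₂ : ℕ) {z₁ z₂ : ℂ} (h₁ : ‖z₁‖ < 1 / 4) (h₂ : ‖z₂‖ < 1 / 4) :
    4 ≤ (-(a₁ : ℂ) + z₁).re + (-(a₂ : ℂ) + z₂).re + ((a₁ + a₂ + 6 : ℕ) : ℝ) := by
  have h1 := abs_re_lt_of_norm_lt h₁
  have h2 := abs_re_lt_of_norm_lt h₂
  simp only [Complex.add_re, Complex.neg_re, Complex.natCast_re]
  push_cast
  linarith

theorem norm_add_lt_one {z₁ z₂ : ℂ} (h₁ : ‖z₁‖ < 1 / 4) (h₂ : ‖z₂‖ < 1 / 4) : ‖z₁ + z₂‖ < 1 :=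
  (norm_add_le _ _).trans_lt (by linarith)

/-- The regularized nested sum at `(-a₁, -a₂)` near the origin. -/
theorem regNestedSum_neg_natCast (a₁ a₂ : ℕ) {z₁ z₂ : ℂ} (h₁ : ‖z₁‖ < 1 / 4) (h₂ : ‖z₂‖ < 1 / 4)
    (h0 : z₁ ≠ 0) (h12 : z₁ + z₂ ≠ 0) :
    CutoffChenSumDefined (twistedReg [z₁, z₂] (symbolWord [-(a₁ : ℂ), -(a₂ : ℂ)])) ∧
    regNestedSum [-(a₁ : ℂ), -(a₂ : ℂ)] [z₁, z₂] = regularPart a₁ a₂ z₁ z₂ +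
      z₂ * polarCoeff a₁ a₂ z₂ * ((z₁ + z₂)⁻¹ * riemannZeta₁ (1 + (z₁ + z₂))) := by
  have hn := norm_add_lt_one h₁ h₂
  have f1 := hasFinitePart_pair (K := a₁ + a₂ + 6) (s₁ := -(a₁ : ℂ) + z₁) (s₂ := -(a₂ : ℂ) + z₂)
    (by omega) (neg_natCast_add_mem_emDomain a₁ a₂ h₂) (add_natCast_ne_one (by linarith) h0)
    (fun k hk => h12 (eq_zero_of_eq_intCast hn (n := 2 + a₁ + a₂ - k) (by
      push_cast; linear_combination hk)))
    (four_le_re_add_re a₁ a₂ h₁ h₂)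
  have f2 : HasFinitePart (chenPartialSum [-(a₁ : ℂ) + -(a₂ : ℂ) + (z₁ + z₂)]) _ :=
    hasFinitePart_singleton fun k hk => h12 (eq_zero_of_eq_intCast hn (n := 1 + a₁ + a₂ - k) (by
      push_cast; linear_combination hk))
  have f3 : HasFinitePart (chenPartialSum [-(a₁ : ℂ) + -(a₂ : ℂ) + z₁]) _ :=
    hasFinitePart_singleton fun k hk => h0 (eq_zero_of_eq_intCast (by linarith)
      (n := 1 + a₁ + a₂ - k) (by push_cast; linear_combination hk))
  constructor
  · rw [twistedReg_pair, sub_eq_add_neg, ← neg_smul]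
    exact ((cutoffChenSumDefined_symbolWord f1).add
      ((cutoffChenSumDefined_symbolWord f2).smul _)).add
        ((cutoffChenSumDefined_symbolWord f3).smul _)
  · rw [regNestedSum, twistedReg_pair, map_sub, map_add, map_smul, map_smul,
      cutoffChenSum_symbolWord f1, cutoffChenSum_symbolWord f2, cutoffChenSum_symbolWord f3,
      pairFinitePart, regularPart, ← Finset.sum_erase_add _ _ (Finset.mem_range.mpr
        (show a₁ + a₂ + 2 < a₁ + a₂ + 6 + 1 by omega)), emCoeff_eq_mul_polarCoeff]
    -- At the isolated index zeta is evaluated next to its pole; `riemannZeta₁` is the entire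
    -- function `(s - 1) ζ(s)`, equal to `1` at `s = 1`.
    have e : -(a₁ : ℂ) + z₁ + (-(a₂ : ℂ) + z₂) - 1 + ((a₁ + a₂ + 2 : ℕ) : ℂ) = 1 + (z₁ + z₂) := by
      push_cast
      ring
    rw [e, riemannZeta_eq_inv_sub_mul (s := 1 + (z₁ + z₂)) (by simpa using h12),
      add_sub_cancel_left, smul_eq_mul, smul_eq_mul]
    ring

theorem differentiableOn_regularPart (a₁ a₂ : ℕ) {U : Set ℂ} (hU : IsOpen U) {γ₁ γ₂ : ℂ → ℂ}
    (h₁ : DifferentiableOn ℂ γ₁ U) (h₂ : DifferentiableOn ℂ γ₂ U)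
    (hγ₁ : ∀ z ∈ U, ‖γ₁ z‖ < 1 / 4) (hγ₂ : ∀ z ∈ U, ‖γ₂ z‖ < 1 / 4) :
    DifferentiableOn ℂ (fun z => regularPart a₁ a₂ (γ₁ z) (γ₂ z)) U := by
  have hζ : ∀ {g : ℂ → ℂ}, DifferentiableOn ℂ g U → (∀ z ∈ U, g z ≠ 1) →
      DifferentiableOn ℂ (fun z => riemannZeta (g z)) U :=
    fun hg h => differentiableOn_riemannZeta.comp hg h
  have hne : ∀ {z : ℂ}, ‖z‖ < 1 → -(a₁ : ℂ) + -(a₂ : ℂ) + z ≠ 1 := by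
    intro z hz h
    refine neg_natCast_add_ne_one (a₁ + a₂) hz ?_
    push_cast
    linear_combination h
  unfold regularPart
  refine (((hζ (h₂.const_add _) fun z hz => ?_).mul (hζ (h₁.const_add _) fun z hz => ?_)).add
    (DifferentiableOn.fun_sum fun j hj => DifferentiableOn.mul ?_ (hζ ?_ fun z hz => ?_))).add
    (differentiableOn_emPairTail (by omega) hU (h₁.const_add _) (h₂.const_add _) (fun z hz => ?_)
      (fun z hz => ?_) (M := a₂ + 1 / 4) fun z hz => ?_) |>.add
    (((hζ ((h₁.add h₂).const_add _) fun z hz => ?_).const_mul _).sub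
      ((hζ (h₁.const_add _) fun z hz => ?_).const_mul _))
  · exact neg_natCast_add_ne_one _ (by linarith [hγ₂ z hz])
  · exact neg_natCast_add_ne_one _ (by linarith [hγ₁ z hz])
  · exact (differentiableOn_emCoeff j).comp (h₂.const_add _) fun z hz =>
      neg_natCast_add_ne_one _ (by linarith [hγ₂ z hz])
  · exact (((h₁.const_add _).add (h₂.const_add _)).sub_const _).add_const _
  -- Argument `1` would force `j = a₁ + a₂ + 2`, the erased index.
  · intro h
    have hn := norm_add_lt_one (hγ₁ z hz) (hγ₂ z hz)
    have h0 := eq_zero_of_eq_intCast hn (n := 2 + a₁ + a₂ - j) (by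
      push_cast; linear_combination h)
    have hj' : (j : ℂ) = ((a₁ + a₂ + 2 : ℕ) : ℂ) := by
      push_cast
      linear_combination h - h0
    exact (Finset.mem_erase.mp hj).1 (by exact_mod_cast hj')
  · exact neg_natCast_add_mem_emDomain a₁ a₂ (hγ₂ z hz)
  · exact four_le_re_add_re a₁ a₂ (hγ₁ z hz) (hγ₂ z hz)
  · refine (norm_add_le _ _).trans ?_
    rw [norm_neg, Complex.norm_natCast]
    linarith [hγ₂ z hz]
  · exact hne (norm_add_lt_one (hγ₁ z hz) (hγ₂ z hz))
  · exact hne (by linarith [hγ₁ z hz])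

theorem analyticAt_regularPart (a₁ a₂ : ℕ) {γ₁ γ₂ : ℂ → ℂ} (h₁ : Differentiable ℂ γ₁)
    (h₂ : Differentiable ℂ γ₂) (hγ₁ : ‖γ₁ 0‖ < 1 / 4) (hγ₂ : ‖γ₂ 0‖ < 1 / 4) :
    AnalyticAt ℂ (fun z => regularPart a₁ a₂ (γ₁ z) (γ₂ z)) 0 := by
  have hU : IsOpen {z | ‖γ₁ z‖ < 1 / 4 ∧ ‖γ₂ z‖ < 1 / 4} :=
    (isOpen_lt h₁.continuous.norm continuous_const).inter
      (isOpen_lt h₂.continuous.norm continuous_const)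
  exact (differentiableOn_regularPart a₁ a₂ hU h₁.differentiableOn h₂.differentiableOn
    (fun z hz => hz.1) (fun z hz => hz.2)).analyticAt (hU.mem_nhds ⟨hγ₁, hγ₂⟩)

/-! ### Iterated and diagonal evaluations -/

theorem eventually_norm_lt_quarter : ∀ᶠ z in 𝓝[≠] (0 : ℂ), ‖z‖ < 1 / 4 ∧ z ≠ 0 := by
  filter_upwards [mem_nhdsWithin_of_mem_nhds (Metric.ball_mem_nhds (0 : ℂ)
    (show (0 : ℝ) < 1 / 4 by norm_num)), self_mem_nhdsWithin] with z hz hz0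
  exact ⟨by simpa using hz, hz0⟩

theorem analyticAt_riemannZeta₁_comp {g : ℂ → ℂ} (hg : Differentiable ℂ g) (z : ℂ) :
    AnalyticAt ℂ (fun z => riemannZeta₁ (g z)) z :=
  (differentiable_riemannZeta₁.comp hg).analyticAt z

/-- The evaluation of the first variable at `0`. -/
theorem regNestedSum_fst_germ (a₁ a₂ : ℕ) {z₂ : ℂ} (h₂ : ‖z₂‖ < 1 / 4) (h0 : z₂ ≠ 0) :
    MeromorphicAt (fun z₁ => regNestedSum [-(a₁ : ℂ), -(a₂ : ℂ)] [z₁, z₂]) 0 ∧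
    evReg (fun z₁ => regNestedSum [-(a₁ : ℂ), -(a₂ : ℂ)] [z₁, z₂]) =
      regularPart a₁ a₂ 0 z₂ + polarCoeff a₁ a₂ z₂ * riemannZeta₁ (1 + z₂) := by
  set g : ℂ → ℂ := fun z₁ => regularPart a₁ a₂ z₁ z₂ +
    z₂ * polarCoeff a₁ a₂ z₂ * ((z₁ + z₂)⁻¹ * riemannZeta₁ (1 + (z₁ + z₂))) with hg
  have hga : AnalyticAt ℂ g 0 := by
    refine (analyticAt_regularPart a₁ a₂ (γ₁ := fun z => z) (γ₂ := fun _ => z₂) (by fun_prop)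
      (by fun_prop) (by norm_num) h₂).add (analyticAt_const.mul (AnalyticAt.mul ?_ ?_))
    · exact AnalyticAt.fun_inv (by fun_prop) (by simpa using h0)
    · exact analyticAt_riemannZeta₁_comp (by fun_prop) 0
  have heq : (fun z₁ => regNestedSum [-(a₁ : ℂ), -(a₂ : ℂ)] [z₁, z₂]) =ᶠ[𝓝[≠] 0] g := by
    have hne : ∀ᶠ z in 𝓝[≠] (0 : ℂ), z + z₂ ≠ 0 := by
      refine mem_nhdsWithin_of_mem_nhds ?_
      exact (show Continuous fun z : ℂ => z + z₂ by fun_prop).continuousAt.eventually_ne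
        (by simpa using h0)
    filter_upwards [eventually_norm_lt_quarter, hne] with z hz hz'
    exact (regNestedSum_neg_natCast a₁ a₂ hz.1 h₂ hz.2 hz').2
  refine ⟨hga.meromorphicAt.congr heq.symm, ?_⟩
  rw [evReg_eq hga heq, hg]
  -- At `z₁ = 0` the factor `z₂` cancels the inverse of `z₁ + z₂`, so the polar coefficient survives
  -- in full.
  simp only [zero_add]
  field_simp

/-- The evaluation of the second variable at `0`. -/
theorem regNestedSum_snd_germ (a₁ a₂ : ℕ) {z₁ : ℂ} (h₁ : ‖z₁‖ < 1 / 4) (h0 : z₁ ≠ 0) :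
    MeromorphicAt (fun z₂ => regNestedSum [-(a₁ : ℂ), -(a₂ : ℂ)] [z₁, z₂]) 0 ∧
    evReg (fun z₂ => regNestedSum [-(a₁ : ℂ), -(a₂ : ℂ)] [z₁, z₂]) = regularPart a₁ a₂ z₁ 0 := by
  set g : ℂ → ℂ := fun z₂ => regularPart a₁ a₂ z₁ z₂ +
    z₂ * polarCoeff a₁ a₂ z₂ * ((z₁ + z₂)⁻¹ * riemannZeta₁ (1 + (z₁ + z₂))) with hg
  have hga : AnalyticAt ℂ g 0 := by
    refine (analyticAt_regularPart a₁ a₂ (γ₁ := fun _ => z₁) (γ₂ := fun z => z) (by fun_prop)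
      (by fun_prop) h₁ (by norm_num)).add ((analyticAt_id.mul
        ((differentiable_polarCoeff a₁ a₂).analyticAt 0)).mul (AnalyticAt.mul ?_ ?_))
    · exact AnalyticAt.fun_inv (by fun_prop) (by simpa using h0)
    · exact analyticAt_riemannZeta₁_comp (by fun_prop) 0
  have heq : (fun z₂ => regNestedSum [-(a₁ : ℂ), -(a₂ : ℂ)] [z₁, z₂]) =ᶠ[𝓝[≠] 0] g := by
    have hne : ∀ᶠ z in 𝓝[≠] (0 : ℂ), z₁ + z ≠ 0 := by
      refine mem_nhdsWithin_of_mem_nhds ?_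
      exact (show Continuous fun z : ℂ => z₁ + z by fun_prop).continuousAt.eventually_ne
        (by simpa using h0)
    filter_upwards [eventually_norm_lt_quarter, hne] with z hz hz'
    exact (regNestedSum_neg_natCast a₁ a₂ h₁ hz.1 h0 hz').2
  refine ⟨hga.meromorphicAt.congr heq.symm, ?_⟩
  rw [evReg_eq hga heq, hg]
  -- For `z₁ ≠ 0` the factor `z₂` kills the singular term at `z₂ = 0`.
  simp

/-- The common value of the two renormalizations. -/
noncomputable def renormalizedValue (a₁ a₂ : ℕ) : ℂ :=
  regularPart a₁ a₂ 0 0 + 1 / 2 * polarCoeff a₁ a₂ 0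

theorem evRenSym_regNestedSum (a₁ a₂ : ℕ) :
    EvRenSymDefined (fun z₁ z₂ => regNestedSum [-(a₁ : ℂ), -(a₂ : ℂ)] [z₁, z₂]) ∧
    zetaEv (-(a₁ : ℂ)) (-(a₂ : ℂ)) = renormalizedValue a₁ a₂ := by
  have ha₁ : AnalyticAt ℂ (fun z₂ => regularPart a₁ a₂ 0 z₂ +
      polarCoeff a₁ a₂ z₂ * riemannZeta₁ (1 + z₂)) 0 :=
    (analyticAt_regularPart a₁ a₂ (γ₁ := fun _ => 0) (γ₂ := fun z => z) (by fun_prop)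
      (by fun_prop) (by norm_num) (by norm_num)).add
        (((differentiable_polarCoeff a₁ a₂).analyticAt 0).mul
          (analyticAt_riemannZeta₁_comp (by fun_prop) 0))
  have ha₂ : AnalyticAt ℂ (fun z₁ => regularPart a₁ a₂ z₁ 0) 0 :=
    analyticAt_regularPart a₁ a₂ (γ₁ := fun z => z) (γ₂ := fun _ => 0) (by fun_prop)
      (by fun_prop) (by norm_num) (by norm_num)
  have he₁ : (fun z₂ => evReg fun z₁ => regNestedSum [-(a₁ : ℂ), -(a₂ : ℂ)] [z₁, z₂]) =ᶠ[𝓝[≠] 0]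
      fun z₂ => regularPart a₁ a₂ 0 z₂ + polarCoeff a₁ a₂ z₂ * riemannZeta₁ (1 + z₂) := by
    filter_upwards [eventually_norm_lt_quarter] with z hz
    exact (regNestedSum_fst_germ a₁ a₂ hz.1 hz.2).2
  have he₂ : (fun z₁ => evReg fun z₂ => regNestedSum [-(a₁ : ℂ), -(a₂ : ℂ)] [z₁, z₂]) =ᶠ[𝓝[≠] 0]
      fun z₁ => regularPart a₁ a₂ z₁ 0 := by
    filter_upwards [eventually_norm_lt_quarter] with z hz
    exact (regNestedSum_snd_germ a₁ a₂ hz.1 hz.2).2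
  refine ⟨⟨?_, ha₁.meromorphicAt.congr he₁.symm, ?_, ha₂.meromorphicAt.congr he₂.symm⟩, ?_⟩
  · filter_upwards [eventually_norm_lt_quarter] with z hz
    exact (regNestedSum_fst_germ a₁ a₂ hz.1 hz.2).1
  · filter_upwards [eventually_norm_lt_quarter] with z hz
    exact (regNestedSum_snd_germ a₁ a₂ hz.1 hz.2).1
  · rw [zetaEv, evRenSym, evReg_eq ha₁ he₁, evReg_eq ha₂ he₂, renormalizedValue]
    simp only [add_zero, riemannZeta₁_one]
    ring

/-- On the diagonal `z₂ / (z₁ + z₂)` is constantly `1/2`, matching the mean of the two iterated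
evaluations. -/
theorem diagNestedSum_pair_germ (a₁ a₂ : ℕ) :
    ∃ g : ℂ → ℂ, AnalyticAt ℂ g 0 ∧ diagNestedSum [-(a₁ : ℂ), -(a₂ : ℂ)] =ᶠ[𝓝[≠] 0] g ∧
      g 0 = renormalizedValue a₁ a₂ := by
  refine ⟨fun z => regularPart a₁ a₂ z z + 1 / 2 * polarCoeff a₁ a₂ z * riemannZeta₁ (1 + (z + z)),
    ?_, ?_, ?_⟩
  · exact (analyticAt_regularPart a₁ a₂ (γ₁ := fun z => z) (γ₂ := fun z => z) (by fun_prop)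
      (by fun_prop) (by norm_num) (by norm_num)).add
        ((analyticAt_const.mul ((differentiable_polarCoeff a₁ a₂).analyticAt 0)).mul
          (analyticAt_riemannZeta₁_comp (by fun_prop) 0))
  · filter_upwards [eventually_norm_lt_quarter] with z hz
    have hz2 : z + z ≠ 0 := by simpa using hz.2
    refine (regNestedSum_neg_natCast a₁ a₂ hz.1 hz.1 hz.2 hz2).2.trans ?_
    have e : z * (z + z)⁻¹ = 1 / 2 := by
      have := hz.2
      field_simp
      ring
    linear_combination polarCoeff a₁ a₂ z * riemannZeta₁ (1 + (z + z)) * e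
  · simp [renormalizedValue]

theorem diagNestedSum_singleton_germ (a : ℕ) :
    (∀ᶠ z in 𝓝[≠] (0 : ℂ), CutoffChenSumDefined (twistedReg [z] (symbolWord [-(a : ℂ)]))) ∧
    ∃ g : ℂ → ℂ, AnalyticAt ℂ g 0 ∧ diagNestedSum [-(a : ℂ)] =ᶠ[𝓝[≠] 0] g := by
  have hf : ∀ z : ℂ, ‖z‖ < 1 / 4 ∧ z ≠ 0 →
      HasFinitePart (chenPartialSum [-(a : ℂ) + z]) (riemannZeta (-(a : ℂ) + z)) :=
    fun z hz => hasFinitePart_singleton (add_natCast_ne_one (by linarith [hz.1]) hz.2)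
  constructor
  · filter_upwards [eventually_norm_lt_quarter] with z hz
    rw [twistedReg_singleton]
    exact cutoffChenSumDefined_symbolWord (hf z hz)
  · refine ⟨fun z => riemannZeta (-(a : ℂ) + z), ?_, ?_⟩
    · have h := differentiableOn_riemannZeta.comp (s := Metric.ball 0 1)
        (show DifferentiableOn ℂ (fun z : ℂ => -(a : ℂ) + z) _ by fun_prop)
        fun z hz => neg_natCast_add_ne_one a (by simpa using hz)
      exact h.analyticAt (Metric.ball_mem_nhds _ one_pos)
    · filter_upwards [eventually_norm_lt_quarter] with z hz
      rw [diagNestedSum, regNestedSum, List.length_singleton, List.replicate_one,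
        twistedReg_singleton, cutoffChenSum_symbolWord (hf z hz)]

/-! ### Closed formula in Bernoulli numbers -/

/-- The formula for the renormalized value in terms of `bernoulli'`. -/
def doubleZetaFormula (a₁ a₂ : ℕ) : ℚ :=
  -(1 / ((a₂ : ℚ) + 1)) * ∑ j ∈ Finset.range (a₂ + 2),
      bernoulli j * ((a₂ + 1).choose j : ℚ) *
        (bernoulli' (a₁ + a₂ + 2 - j) / ((a₁ : ℚ) + a₂ - j + 2))
    + bernoulli' (a₁ + 1) / ((a₁ : ℚ) + 1) * (bernoulli' (a₂ + 1) / ((a₂ : ℚ) + 1))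
    + (-1) ^ (a₁ + 1) * (a₁.factorial : ℚ) * (a₂.factorial : ℚ) *
        (bernoulli (a₁ + a₂ + 2) / (2 * ((a₁ + a₂ + 2).factorial : ℚ)))

/-- At the origin the twist corrections cancel, the remainder vanishes, and the binomial
coefficients cut the sum at `j = a₂ + 1`, below the erased index. -/
theorem regularPart_zero (a₁ a₂ : ℕ) : regularPart a₁ a₂ 0 0 =
    riemannZeta (-(a₂ : ℂ)) * riemannZeta (-(a₁ : ℂ)) + ∑ j ∈ Finset.range (a₂ + 2),
      (bernoulli j : ℂ) * ((a₂ + 1).choose j : ℂ) / ((a₂ : ℂ) + 1) *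
        riemannZeta (-((a₁ + a₂ + 1 - j : ℕ) : ℂ)) := by
  have h0 : fallingNeg (a₁ + a₂ + 6) (-(a₂ : ℂ)) = 0 := by
    rw [fallingNeg_neg_natCast, Nat.descFactorial_of_lt (by omega), Nat.cast_zero]
  simp only [regularPart, add_zero, sub_self, emPairTail_eq_zero h0, emCoeff_neg_natCast]
  congr 1
  symm
  refine Finset.sum_subset_zero_on_sdiff ?_ ?_ ?_
  · intro j hj
    rw [Finset.mem_range] at hj
    rw [Finset.mem_erase, Finset.mem_range]
    omega
  · intro j hj
    rw [Finset.mem_sdiff, Finset.mem_range, not_lt] at hj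
    rw [Nat.choose_eq_zero_of_lt (by omega)]
    simp
  · intro j hj
    rw [Finset.mem_range] at hj
    congr 2
    rw [Nat.cast_sub (by omega)]
    push_cast
    ring

theorem renormalizedValue_eq (a₁ a₂ : ℕ) :
    renormalizedValue a₁ a₂ = ((doubleZetaFormula a₁ a₂ : ℚ) : ℂ) := by
  rw [renormalizedValue, regularPart_zero, polarCoeff_zero, doubleZetaFormula]
  push_cast
  rw [riemannZeta_neg_nat_eq_bernoulli', riemannZeta_neg_nat_eq_bernoulli', Finset.mul_sum]
  have e : ∀ j ∈ Finset.range (a₂ + 2),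
      (bernoulli j : ℂ) * ((a₂ + 1).choose j : ℂ) / ((a₂ : ℂ) + 1) *
        riemannZeta (-((a₁ + a₂ + 1 - j : ℕ) : ℂ)) =
      -(1 / ((a₂ : ℂ) + 1)) * ((bernoulli j : ℂ) * ((a₂ + 1).choose j : ℂ) *
        ((bernoulli' (a₁ + a₂ + 2 - j) : ℂ) / ((a₁ : ℂ) + a₂ - j + 2))) := by
    intro j hj
    rw [Finset.mem_range] at hj
    rw [riemannZeta_neg_nat_eq_bernoulli', show a₁ + a₂ + 1 - j + 1 = a₁ + a₂ + 2 - j by omega,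
      Nat.cast_sub (by omega)]
    have : ((a₁ + a₂ + 1 : ℕ) : ℂ) - j + 1 = (a₁ : ℂ) + a₂ - j + 2 := by push_cast; ring
    rw [this]
    ring
  rw [Finset.sum_congr rfl e]
  ring

/-- The two conventions differ only at index `1`. For `j ≤ a₂` the index is at least `2`; the term
`j = a₂ + 1`, the only one that can reach index `1`, cancels against the product term in either
convention. -/
theorem doubleZetaFormula_eq_bernoulli (a₁ : ℕ) {a₂ : ℕ} (h : 1 ≤ a₂) :
    doubleZetaFormula a₁ a₂ =
      -(1 / ((a₂ : ℚ) + 1)) * ∑ j ∈ Finset.range (a₂ + 2),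
          bernoulli j * ((a₂ + 1).choose j : ℚ) *
            (bernoulli (a₁ + a₂ + 2 - j) / ((a₁ : ℚ) + a₂ - j + 2))
        + bernoulli (a₁ + 1) / ((a₁ : ℚ) + 1) * (bernoulli (a₂ + 1) / ((a₂ : ℚ) + 1))
        + (-1) ^ (a₁ + 1) * (a₁.factorial : ℚ) * (a₂.factorial : ℚ) *
            (bernoulli (a₁ + a₂ + 2) / (2 * ((a₁ + a₂ + 2).factorial : ℚ))) := by
  rw [doubleZetaFormula, Finset.sum_range_succ, Finset.sum_range_succ _ (a₂ + 1),
    bernoulli_eq_bernoulli'_of_ne_one (n := a₂ + 1) (by omega)]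
  have e : ∀ j ∈ Finset.range (a₂ + 1), bernoulli' (a₁ + a₂ + 2 - j) =
      bernoulli (a₁ + a₂ + 2 - j) := by
    intro j hj
    rw [Finset.mem_range] at hj
    exact (bernoulli_eq_bernoulli'_of_ne_one (by omega)).symm
  rw [Finset.sum_congr rfl fun j hj => by rw [e j hj],
    show a₁ + a₂ + 2 - (a₂ + 1) = a₁ + 1 by omega, Nat.choose_self]
  have e2 : (a₁ : ℚ) + a₂ - (a₂ + 1 : ℕ) + 2 = a₁ + 1 := by push_cast; ring
  rw [e2]
  ring

theorem mainTheorem5 (a₁ a₂ : ℕ) :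
    -- the regularized nested sums are defined and meromorphic where they are evaluated
    ((∀ᶠ z : ℂ × ℂ in 𝓝 (0, 0), z.1 ≠ 0 → z.1 + z.2 ≠ 0 →
        CutoffChenSumDefined
          (twistedReg [z.1, z.2] (symbolWord [-(a₁ : ℂ), -(a₂ : ℂ)]))) ∧
      EvRenSymDefined
        (fun z₁ z₂ => regNestedSum [-(a₁ : ℂ), -(a₂ : ℂ)] [z₁, z₂])) ∧
    -- the values given by the symmetrized evaluator
    zetaEv (-(a₁ : ℂ)) (-(a₂ : ℂ)) =
      ((-(1 / ((a₂ : ℚ) + 1)) * ∑ j ∈ Finset.range (a₂ + 2),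
            bernoulli j * ((a₂ + 1).choose j : ℚ) *
              (bernoulli' (a₁ + a₂ + 2 - j) / ((a₁ : ℚ) + a₂ - j + 2))
          + bernoulli' (a₁ + 1) / ((a₁ : ℚ) + 1) * (bernoulli' (a₂ + 1) / ((a₂ : ℚ) + 1))
          + (-1) ^ (a₁ + 1) * (a₁.factorial : ℚ) * (a₂.factorial : ℚ) *
              (bernoulli (a₁ + a₂ + 2) / (2 * ((a₁ + a₂ + 2).factorial : ℚ))) : ℚ) : ℂ) ∧
    -- for `a₂ ≥ 1` all Bernoulli numbers can be taken with `B₁ = -1/2`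
    (1 ≤ a₂ → zetaEv (-(a₁ : ℂ)) (-(a₂ : ℂ)) =
      ((-(1 / ((a₂ : ℚ) + 1)) * ∑ j ∈ Finset.range (a₂ + 2),
            bernoulli j * ((a₂ + 1).choose j : ℚ) *
              (bernoulli (a₁ + a₂ + 2 - j) / ((a₁ : ℚ) + a₂ - j + 2))
          + bernoulli (a₁ + 1) / ((a₁ : ℚ) + 1) * (bernoulli (a₂ + 1) / ((a₂ : ℚ) + 1))
          + (-1) ^ (a₁ + 1) * (a₁.factorial : ℚ) * (a₂.factorial : ℚ) *
              (bernoulli (a₁ + a₂ + 2) / (2 * ((a₁ + a₂ + 2).factorial : ℚ))) : ℚ) : ℂ)) ∧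
    (∃ q : ℚ, zetaEv (-(a₁ : ℂ)) (-(a₂ : ℂ)) = (q : ℂ)) ∧
    -- the values given by the algebraic Birkhoff decomposition
    (∀ w ∈ ({[-(a₁ : ℂ)], [-(a₂ : ℂ)], [-(a₁ : ℂ), -(a₂ : ℂ)]} : Set (List ℂ)),
      (∀ᶠ z in 𝓝[≠] (0 : ℂ),
        CutoffChenSumDefined (twistedReg (List.replicate w.length z) (symbolWord w))) ∧
      MeromorphicAt (diagNestedSum w) 0) ∧
    (∃! φ : (SymbolTensor →ₗ[ℂ] LaurentSeries ℂ) × (SymbolTensor →ₗ[ℂ] LaurentSeries ℂ),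
      IsBirkhoffDecomposition diagNestedSumLaurent φ.1 φ.2) ∧
    (∀ φm φp : SymbolTensor →ₗ[ℂ] LaurentSeries ℂ,
      IsBirkhoffDecomposition diagNestedSumLaurent φm φp →
        (φp (symbolWord [-(a₁ : ℂ), -(a₂ : ℂ)])).coeff 0 =
          zetaEv (-(a₁ : ℂ)) (-(a₂ : ℂ))) := by
  obtain ⟨hdef, hval⟩ := evRenSym_regNestedSum a₁ a₂
  have hval' := hval.trans (renormalizedValue_eq a₁ a₂)
  have hsing : ∀ a : ℕ, (∀ᶠ z in 𝓝[≠] (0 : ℂ), CutoffChenSumDefined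
      (twistedReg (List.replicate [-(a : ℂ)].length z) (symbolWord [-(a : ℂ)]))) ∧
      MeromorphicAt (diagNestedSum [-(a : ℂ)]) 0 := by
    intro a
    obtain ⟨h1, g, hg, h2⟩ := diagNestedSum_singleton_germ a
    exact ⟨h1, hg.meromorphicAt.congr h2.symm⟩
  obtain ⟨g, hg, hdiag, hg0⟩ := diagNestedSum_pair_germ a₁ a₂
  refine ⟨⟨?_, hdef⟩, hval', ?_, ⟨_, hval'⟩, ?_,
    existsUnique_isBirkhoffDecomposition _ diagNestedSumLaurent_nil, ?_⟩
  · have hq : (0 : ℝ) < 1 / 4 := by norm_num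
    filter_upwards [prod_mem_nhds (Metric.ball_mem_nhds (0 : ℂ) hq)
      (Metric.ball_mem_nhds (0 : ℂ) hq)] with z hz h0 h12
    exact (regNestedSum_neg_natCast a₁ a₂ (by simpa using hz.1) (by simpa using hz.2) h0 h12).1
  · intro h
    rw [hval', doubleZetaFormula_eq_bernoulli a₁ h]
  · rintro w (rfl | rfl | rfl)
    · exact hsing a₁
    · exact hsing a₂
    · refine ⟨?_, hg.meromorphicAt.congr hdiag.symm⟩
      filter_upwards [eventually_norm_lt_quarter] with z hz
      exact (regNestedSum_neg_natCast a₁ a₂ hz.1 hz.1 hz.2 (by simpa using hz.2)).1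
  · intro φm φp h
    obtain ⟨-, g₁, hg₁, h₁⟩ := diagNestedSum_singleton_germ a₁
    rw [h.coeff_zero_pair diagNestedSumLaurent_nil, hval, ← hg0, ← coeff_zero_laurentGerm hg hdiag,
      diagNestedSumLaurent, linearCombination_symbolWord]
    rw [diagNestedSumLaurent, linearCombination_symbolWord]
    exact polePart_laurentGerm hg₁ h₁
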